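/- Let $q\ge 2$ and $w\ge 1$ be integers. Let $u_1,\dots,u_w$ be independent Haar-distributed unitaries in $U(q^2)$, acting on $\mathbb C^q\otimes\mathbb C^q$ (a left and a right leg), and let $\mathcal U_k=u_k\otimes\bar u_k\otimes u_k\otimes\bar u_k$ be their fourfold replicas, acting on two legs of dimension $q^4$. On a replicated leg $(\mathbb C^q)^{\otimes 4}$ (copies numbered $0,1,2,3$) let $$|0\rangle=q^{-1/2}\sum_{a,b}|a\,a\,b\,b\rangle,\qquad |1\rangle=q^{-1/2}\sum_{a,b}|a\,b\,b\,a\rangle ,$$ so that $\langle i|i\rangle=q$ and $\langle 0|1\rangle=1$. The light-like generator of the spatial-temporal random Haar-random model of width $w$ is the operator on $\big((\mathbb C^q)^{\otimes4}\big)^{\otimes w}$ with entries $$(T_w)_{(i_1\dots i_w),(j_1\dots j_w)}=\mathbb E\sum_{\mu_0,\dots,\mu_w}\langle 0|\mu_0\rangle\Big(\prod_{k=1}^w\langle i_k\,\mu_k|\,\mathcal U_k\,|\mu_{k-1}\,j_k\rangle\Big)\langle\mu_w|1\rangle ,$$ where $i_k,j_k,\mu_k$ run over the basis of a replicated leg.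 Put $z_2=q^2/(q^2+1)$. 1. $1$ is an eigenvalue of $T_w$ of algebraic multiplicity one, $z_2$ is the subleading eigenvalue (every eigenvalue other than $1$ and $z_2$ has modulus less than $z_2$), and $z_2$ has algebraic multiplicity $w$ and geometric multiplicity one; on its generalized eigenspace $T_w$ is a single Jordan block of size $w$. 2. The span $V_w$ of the vectors $|0^m\rangle\otimes|1^{w-m}\rangle$, $0\le m\le w$, is invariant under $T_w$ and $T_w^\dagger$ and contains the generalized eigenspace of $z_2$. The vectors $e_w=q^{-w/2}|0^w\rangle$ and $$e_m=|0^m\rangle\otimes\frac{q|1\rangle-|0\rangle}{q^{w/2}\sqrt{q^2-1}}\otimes|1^{w-m-1}\rangle\qquad(0\le m\le w-1)$$ form an orthonormal basis of $V_w$ in which $T_w$ is lower triangular: $\langle e_m|T_w|e_n\rangle=0$ for $m<n$, $\langle e_m|T_w|e_m\rangle=z_2$ for $m\le w-1$, $\langle e_w|T_w|e_w\rangle=1$, and $\langle e_{m+1}|T_w|e_m\rangle=q^3/(q^2+1)^2$ for $m\le w-2$. -/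

import Mathlib

open MeasureTheory

namespace HRM

noncomputable section

/-! ### The circular unitary ensemble of two-site gates -/

/-- Two-site gates on `ℂ^q ⊗ ℂ^q`, i.e. the group `U(q²)`.  The entry `u (a', b') (a, b)` is the
amplitude from the input `a` (left leg), `b` (right leg) to the output `a'` (left), `b'` (right). -/
abbrev Gate (q : ℕ) : Type := Matrix.unitaryGroup (Fin q × Fin q) ℂ

instance gateMeasurableSpace (q : ℕ) : MeasurableSpace (Gate q) := borel (Gate q)

instance gateBorelSpace (q : ℕ) : BorelSpace (Gate q) := ⟨rfl⟩

instance gateCompactSpace (q : ℕ) : CompactSpace (Gate q) := by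
  have hcl : IsClosed
      ((Matrix.unitaryGroup (Fin q × Fin q) ℂ : Submonoid _) :
        Set (Matrix (Fin q × Fin q) (Fin q × Fin q) ℂ)) := by
    have : ((Matrix.unitaryGroup (Fin q × Fin q) ℂ : Submonoid _) :
        Set (Matrix (Fin q × Fin q) (Fin q × Fin q) ℂ)) = {A | A * star A = 1} := by
      ext A
      exact Matrix.mem_unitaryGroup_iff
    rw [this]
    exact isClosed_eq (by fun_prop) continuous_const
  have hK : IsCompact
      (Set.pi Set.univ fun _ : Fin q × Fin q => Set.pi Set.univ fun _ : Fin q × Fin q =>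
        Metric.closedBall (0 : ℂ) 1) :=
    isCompact_univ_pi fun _ => isCompact_univ_pi fun _ => isCompact_closedBall _ _
  have hc : IsCompact
      ((Matrix.unitaryGroup (Fin q × Fin q) ℂ : Submonoid _) :
        Set (Matrix (Fin q × Fin q) (Fin q × Fin q) ℂ)) := by
    refine IsCompact.of_isClosed_subset hK hcl ?_
    intro U hU i _ j _
    simpa using entry_norm_bound_of_unitary hU i j
  exact isCompact_iff_compactSpace.mp hc

/-- The circular unitary ensemble `CUE(q²)`: Haar measure on `U(q²)` of total mass one. -/
def cue (q : ℕ) : Measure (Gate q) := Measure.haarMeasure ⊤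

instance cueIsProbabilityMeasure (q : ℕ) : IsProbabilityMeasure (cue q) :=
  ⟨Measure.haarMeasure_self⟩

/-! ### Replicated sites and the light-like generator -/

/-- Basis labels of one replicated site `(ℂ^q)^{⊗ 4}`, the copies `0, 1, 2, 3` carrying
`u, ū, u, ū` respectively. -/
abbrev Site (q : ℕ) : Type := Fin 4 → Fin q

/-- Basis labels of `w` replicated sites. -/
abbrev Config (q w : ℕ) : Type := Fin w → Site q

/-- The Hilbert space `((ℂ^q)^{⊗ 4})^{⊗ w}`. -/
abbrev Space (q w : ℕ) : Type := EuclideanSpace ℂ (Config q w)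

/-- The pairing state `|0⟩` of a replicated site (copies `0, 1` and copies `2, 3` are paired),
normalized so that `⟨0|0⟩ = q`. -/
def ket0 (q : ℕ) (s : Site q) : ℂ :=
  if s 0 = s 1 ∧ s 2 = s 3 then ((1 / √(q : ℝ) : ℝ) : ℂ) else 0

/-- The pairing state `|1⟩` of a replicated site (copies `0, 3` and copies `1, 2` are paired),
normalized so that `⟨1|1⟩ = q`; then `⟨0|1⟩ = 1`. -/
def ket1 (q : ℕ) (s : Site q) : ℂ :=
  if s 0 = s 3 ∧ s 1 = s 2 then ((1 / √(q : ℝ) : ℝ) : ℂ) else 0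

/-- The entry of `u ⊗ ū ⊗ u ⊗ ū` from the input `(a, b)` to the output `(a', b')`
(left and right replicated legs). -/
def replicatedGate {q : ℕ} (u : Gate q) (a' b' a b : Site q) : ℂ :=
  u.val (a' 0, b' 0) (a 0, b 0) * star (u.val (a' 1, b' 1) (a 1, b 1)) *
    (u.val (a' 2, b' 2) (a 2, b 2) * star (u.val (a' 3, b' 3) (a 3, b 3)))

/-- The light-like generator of width `w` of a given family of gates.  The auxiliary leg starts in
`(0|`, enters the `k`-th gate from the left and leaves it to the right into the next gate, and ends
in `|1)`; the `k`-th physical leg enters the `k`-th gate from the right and leaves it to the left. -/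
def llgOfGates (q w : ℕ) (u : Fin w → Gate q) : Matrix (Config q w) (Config q w) ℂ :=
  Matrix.of fun i j => ∑ μ : Fin (w + 1) → Site q,
    ket0 q (μ 0) *
      (∏ k : Fin w, replicatedGate (u k) (i k) (μ k.succ) (μ k.castSucc) (j k)) *
      ket1 q (μ (Fin.last w))

/-- The matrix of the ensemble-averaged light-like generator of the spatial-temporal random
Haar-random model: the gates are independent and `CUE(q²)` distributed. -/
def llgMatrix (q w : ℕ) : Matrix (Config q w) (Config q w) ℂ :=
  Matrix.of fun i j => ∫ u : Fin w → Gate q, llgOfGates q w u i j ∂Measure.pi fun _ => cue q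

/-- The ensemble-averaged light-like generator `T_w` as an operator. -/
def T (q w : ℕ) : Space q w →ₗ[ℂ] Space q w := Matrix.toEuclideanLin (llgMatrix q w)

/-! ### The distinguished subspace -/

/-- The product vector with the single-site factors `φ k`. -/
def productVector {q w : ℕ} (φ : Fin w → Site q → ℂ) : Space q w :=
  WithLp.toLp 2 fun s => ∏ k, φ k (s k)

/-- `|0^m⟩ ⊗ |1^{w-m}⟩`. -/
def domainWall (q w : ℕ) (m : Fin (w + 1)) : Space q w :=
  productVector fun k => if k.val < m.val then ket0 q else ket1 q

/-- The span `V_w` of the vectors `|0^m⟩ ⊗ |1^{w-m}⟩`, `0 ≤ m ≤ w`. -/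
def V (q w : ℕ) : Submodule ℂ (Space q w) := Submodule.span ℂ (Set.range (domainWall q w))

/-- The vectors `e_w = q^{-w/2} |0^w⟩` and, for `m < w`,
`e_m = |0^m⟩ ⊗ (q|1⟩ - |0⟩) / (q^{w/2} √(q²-1)) ⊗ |1^{w-m-1}⟩`. -/
def e (q w : ℕ) (m : Fin (w + 1)) : Space q w :=
  (if m.val = w then ((1 / √(q : ℝ) ^ w : ℝ) : ℂ)
    else ((1 / (√(q : ℝ) ^ w * √((q : ℝ) ^ 2 - 1)) : ℝ) : ℂ)) •
  productVector fun k =>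
    if k.val < m.val then ket0 q
    else if k.val = m.val then fun s => (q : ℂ) * ket1 q s - ket0 q s
    else ket1 q

/-- The `n × n` Jordan block with eigenvalue `z`. -/
def jordanBlock (n : ℕ) (z : ℂ) : Matrix (Fin n) (Fin n) ℂ :=
  Matrix.of fun i j => if i = j then z else if i.val + 1 = j.val then 1 else 0

end

end HRM

/-!
The averaged gate `𝔼 u ⊗ ū ⊗ u ⊗ ū` is invariant under left multiplication by unitaries, so its
columns are combinations of the two pairings of the four copies (`exists_pairing_of_invariant`), and
unitarity fixes the coefficients (`fourthMoment_eq`).  On products of pairing states it acts by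
`|m m⟩ ↦ |m m⟩` and, for `m ≠ t`, `|m t⟩ ↦ κ (|0 0⟩ + |1 1⟩)` with `κ = q/(q²+1)`.  Hence the
generator maps a word `|τ₁ … τ_w⟩` of pairing states to a combination of words `|σ₁ … σ_w⟩`, whose
weight is a product along the chain: the auxiliary leg remembers the last pairing produced
(`T_wordVec`).  The range of the generator is spanned by such words.

On `V_w`, the span of the words with at most one domain wall, the wall only moves to the right
(`eq_orientedWall_of_wordWeight_ne_zero`), so the generator is triangular, with diagonal entries
`κ q = z₂` and one entry `1`, and `inner_e_T_e_of_lt`, `inner_e_T_e_self`, `inner_e_T_e_succ` give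
its matrix in the orthonormal basis.  Reading the chain from its other end (`chain_rev`) shows the
same for the adjoint, so `V_w` and its orthogonal complement are both invariant.

On the complement every eigenvalue is at most `κ² q < κ q = z₂` in modulus
(`norm_le_of_eigen_orthogonal`).  Unitarity makes the first site drop out when it carries `|0⟩`, and
the last site drop out when contracted with `⟨1|`.  Peeling off sites from both ends, an eigenvector
either turns out not to be orthogonal to `V_w`, or it ends up as an eigenvector of the chain
compressed at both ends, which carries a factor `κ²`; the remaining chain has column sums at most
`q` in the basis of words, because `2κ ≤ 1`.

So the generalized eigenspaces of `1` and `z₂` lie in `V_w`, where the characteristic polynomial is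
`(X - z₂)^w (X - 1)` (`charpoly_restrict_of_triangular`).  Since the subdiagonal
entries do not vanish, the eigenspace of `z₂` is a line
(`finrank_eigenspace_le_one_of_triangular`), so there is a single Jordan block
(`exists_jordan_basis`).
-/

namespace HRM

/-! ### Invariants of the fourfold replica -/

/-- The unitary that mixes two distinct basis vectors `a`, `b` by a Hadamard rotation and fixes all
other basis vectors. -/
noncomputable def hadamardOn {ι : Type*} [DecidableEq ι] (a b : ι) : Matrix ι ι ℂ :=
  Matrix.of fun i j =>
    (if i = a then ((1 / √2 : ℝ) : ℂ) else if i = b then ((1 / √2 : ℝ) : ℂ) else 0)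
        * (if j = a then 1 else 0)
      + (if i = a then ((1 / √2 : ℝ) : ℂ) else if i = b then -((1 / √2 : ℝ) : ℂ) else 0)
        * (if j = b then 1 else 0)
      + (if i = a then 0 else if i = b then 0 else 1) * (if j = i then 1 else 0)

lemma inv_sqrt_two_mul_self : ((1 / √2 : ℝ) : ℂ) * ((1 / √2 : ℝ) : ℂ) = 1 / 2 := by
  rw [← Complex.ofReal_mul, div_mul_div_comm, Real.mul_self_sqrt (by norm_num)]
  norm_num

lemma hadamardOn_mem {ι : Type*} [Fintype ι] [DecidableEq ι] {a b : ι} (hab : a ≠ b) :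
    hadamardOn a b ∈ Matrix.unitaryGroup ι ℂ := by
  rw [Matrix.mem_unitaryGroup_iff]
  ext i k
  have h2 := inv_sqrt_two_mul_self
  set s : ℂ := ((1 / √2 : ℝ) : ℂ) with hs
  have hst : star s = s := Complex.conj_ofReal _
  simp only [Matrix.mul_apply, Matrix.star_apply, hadamardOn, Matrix.of_apply, ← hs, star_add,
    Matrix.one_apply, add_mul, mul_add, Finset.sum_add_distrib, apply_ite star, star_one,
    star_zero, star_neg, hst, mul_ite, ite_mul, mul_one, mul_zero, zero_mul,
    Finset.sum_ite_eq', Finset.mem_univ, if_true]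
  clear hst hs
  clear_value s
  have hba := hab.symm
  by_cases hia : i = a
  · subst hia
    grind
  · by_cases hib : i = b
    · subst hib
      grind
    · grind

/-- An invariant of `u ⊗ ū ⊗ u ⊗ ū` is a combination of the two pairings of the four legs: diagonal
phases force the support to be on paired indices, permutations make the coefficients constant, and
a Hadamard rotation of two basis vectors fixes the value at four equal indices. -/
lemma exists_pairing_of_invariant {ι : Type*} [Fintype ι] [DecidableEq ι] [Nontrivial ι]
    (F : ι → ι → ι → ι → ℂ)
    (h : ∀ g ∈ Matrix.unitaryGroup ι ℂ, ∀ x₀ x₁ x₂ x₃, F x₀ x₁ x₂ x₃ =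
      ∑ l₀, ∑ l₁, ∑ l₂, ∑ l₃, g x₀ l₀ * star (g x₁ l₁) * (g x₂ l₂ * star (g x₃ l₃)) *
        F l₀ l₁ l₂ l₃) :
    ∃ α β : ℂ, ∀ x₀ x₁ x₂ x₃, F x₀ x₁ x₂ x₃ =
      α * (if x₀ = x₁ ∧ x₂ = x₃ then 1 else 0) + β * (if x₀ = x₃ ∧ x₁ = x₂ then 1 else 0) := by
  -- the phase `i` at one index `c`
  have hdiag : ∀ c x₀ x₁ x₂ x₃, F x₀ x₁ x₂ x₃ =
      (if x₀ = c then Complex.I else 1) * (if x₁ = c then -Complex.I else 1) *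
      ((if x₂ = c then Complex.I else 1) * (if x₃ = c then -Complex.I else 1)) *
        F x₀ x₁ x₂ x₃ := by
    intro c x₀ x₁ x₂ x₃
    have hg : Matrix.diagonal (fun i => if i = c then Complex.I else 1) ∈
        Matrix.unitaryGroup ι ℂ := by
      rw [Matrix.mem_unitaryGroup_iff, Matrix.star_eq_conjTranspose, Matrix.diagonal_conjTranspose,
        Matrix.diagonal_mul_diagonal, ← Matrix.diagonal_one]
      congr 1
      ext i
      by_cases hi : i = c <;> simp [hi]
    have := h _ hg x₀ x₁ x₂ x₃
    simpa [Matrix.diagonal_apply, apply_ite star] using this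
  have hI1 : Complex.I ≠ 1 := fun h => by simpa using congrArg Complex.re h
  have hI2 : -Complex.I ≠ 1 := fun h => by simpa using congrArg Complex.re h
  have hI3 : (-1 : ℂ) ≠ 1 := by norm_num
  have key : ∀ {z w : ℂ}, z ≠ 1 → w = z * w → w = 0 := by
    intro z w hz hw
    have : (1 - z) * w = 0 := by linear_combination hw
    rcases mul_eq_zero.1 this with h0 | h0
    · exact absurd (sub_eq_zero.1 h0).symm hz
    · exact h0
  have hs0 : ∀ x₀ x₁ x₂ x₃, F x₀ x₁ x₂ x₃ ≠ 0 → x₀ = x₁ ∨ x₀ = x₃ := by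
    intro x₀ x₁ x₂ x₃ hF
    by_contra! hne
    apply hF
    have := hdiag x₀ x₀ x₁ x₂ x₃
    rw [if_pos rfl, if_neg hne.1.symm, if_neg hne.2.symm] at this
    refine key ?_ this
    split_ifs <;> simp [hI1, hI3]
  have hs1 : ∀ x₀ x₁ x₂ x₃, F x₀ x₁ x₂ x₃ ≠ 0 → x₁ = x₀ ∨ x₁ = x₂ := by
    intro x₀ x₁ x₂ x₃ hF
    by_contra! hne
    apply hF
    have := hdiag x₁ x₀ x₁ x₂ x₃
    rw [if_pos (rfl : x₁ = x₁), if_neg hne.1.symm, if_neg hne.2.symm] at this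
    refine key ?_ this
    split_ifs <;> simp [hI2, hI3]
  have hs2 : ∀ x₀ x₁ x₂ x₃, F x₀ x₁ x₂ x₃ ≠ 0 → x₂ = x₁ ∨ x₂ = x₃ := by
    intro x₀ x₁ x₂ x₃ hF
    by_contra! hne
    apply hF
    have := hdiag x₂ x₀ x₁ x₂ x₃
    rw [if_pos (rfl : x₂ = x₂), if_neg hne.1.symm, if_neg hne.2.symm] at this
    refine key ?_ this
    split_ifs <;> simp [hI1, hI3]
  have hs3 : ∀ x₀ x₁ x₂ x₃, F x₀ x₁ x₂ x₃ ≠ 0 → x₃ = x₀ ∨ x₃ = x₂ := by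
    intro x₀ x₁ x₂ x₃ hF
    by_contra! hne
    apply hF
    have := hdiag x₃ x₀ x₁ x₂ x₃
    rw [if_pos (rfl : x₃ = x₃), if_neg hne.1.symm, if_neg hne.2.symm] at this
    refine key ?_ this
    split_ifs <;> simp [hI2, hI3]
  have hperm : ∀ (σ : Equiv.Perm ι) x₀ x₁ x₂ x₃,
      F x₀ x₁ x₂ x₃ = F (σ x₀) (σ x₁) (σ x₂) (σ x₃) := by
    intro σ x₀ x₁ x₂ x₃
    have hg : (Matrix.of fun i j => if σ i = j then (1 : ℂ) else 0) ∈
        Matrix.unitaryGroup ι ℂ := by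
      rw [Matrix.mem_unitaryGroup_iff]
      ext i k
      simp [Matrix.mul_apply, Matrix.one_apply, apply_ite star, eq_comm]
    have := h _ hg x₀ x₁ x₂ x₃
    simpa [apply_ite star] using this
  have htrans : ∀ {a b c d : ι}, a ≠ b → c ≠ d → ∃ σ : Equiv.Perm ι, σ a = c ∧ σ b = d := by
    intro a b c d hab hcd
    have hc : c ≠ Equiv.swap a c b := fun h => hab (by
      apply (Equiv.swap a c).injective; rw [Equiv.swap_apply_left]; exact h)
    refine ⟨Equiv.swap (Equiv.swap a c b) d * Equiv.swap a c, ?_, ?_⟩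
    · simp [Equiv.swap_apply_of_ne_of_ne hc hcd]
    · simp
  obtain ⟨a, b, hab⟩ := exists_pair_ne ι
  have hoff : ∀ {c d : ι}, c ≠ d → F c c d d = F a a b b ∧ F c d d c = F a b b a := by
    intro c d hcd
    obtain ⟨σ, rfl, rfl⟩ := htrans hab hcd
    exact ⟨(hperm σ _ _ _ _).symm, (hperm σ _ _ _ _).symm⟩
  have hdiag4 : ∀ c, F c c c c = F a a a a := by
    intro c
    have := hperm (Equiv.swap a c) a a a a
    simpa using this.symm
  have hzero : ∀ {x₀ x₁ x₂ x₃}, (x₀ ≠ x₁ ∧ x₀ ≠ x₃ ∨ x₁ ≠ x₀ ∧ x₁ ≠ x₂ ∨ x₂ ≠ x₁ ∧ x₂ ≠ x₃ ∨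
      x₃ ≠ x₀ ∧ x₃ ≠ x₂) →
      F x₀ x₁ x₂ x₃ = 0 := by
    intro x₀ x₁ x₂ x₃ hx
    by_contra hF
    have h1 := hs0 _ _ _ _ hF
    have h1' := hs1 _ _ _ _ hF
    have h2 := hs2 _ _ _ _ hF
    have h3 := hs3 _ _ _ _ hF
    tauto
  have hfour : F a a a a = F a a b b + F a b b a := by
    have h1 := h _ (hadamardOn_mem hab) a a a a
    have h2 := inv_sqrt_two_mul_self
    set s : ℂ := ((1 / √2 : ℝ) : ℂ) with hs
    have hst : star s = s := Complex.conj_ofReal _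
    simp only [hadamardOn, Matrix.of_apply, if_true, ← hs, star_add, apply_ite star,
      star_zero, hst, zero_mul, add_zero, mul_ite, mul_one, mul_zero,
      add_mul, mul_add, ite_mul, Finset.sum_add_distrib, Finset.sum_ite_eq', Finset.mem_univ] at h1
    have hba := hab.symm
    rw [hzero (x₀ := a) (x₁ := a) (x₂ := a) (x₃ := b) (by simp [hab, hba]),
      hzero (x₀ := a) (x₁ := a) (x₂ := b) (x₃ := a) (by simp [hab, hba]),
      hzero (x₀ := a) (x₁ := b) (x₂ := a) (x₃ := a) (by simp [hab, hba]),
      hzero (x₀ := b) (x₁ := a) (x₂ := a) (x₃ := a) (by simp [hab, hba]),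
      hzero (x₀ := a) (x₁ := b) (x₂ := a) (x₃ := b) (by simp [hab, hba]),
      hzero (x₀ := b) (x₁ := a) (x₂ := b) (x₃ := a) (by simp [hab, hba]),
      hzero (x₀ := a) (x₁ := b) (x₂ := b) (x₃ := b) (by simp [hab, hba]),
      hzero (x₀ := b) (x₁ := a) (x₂ := b) (x₃ := b) (by simp [hab, hba]),
      hzero (x₀ := b) (x₁ := b) (x₂ := a) (x₃ := b) (by simp [hab, hba]),
      hzero (x₀ := b) (x₁ := b) (x₂ := b) (x₃ := a) (by simp [hab, hba]),
      (hoff hba).1, (hoff hba).2, hdiag4 b] at h1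
    have h4 : s * s * (s * s) = 1 / 4 := by rw [h2]; norm_num
    linear_combination 2 * h1 + 4 * (F a a a a + F a a b b + F a b b a) * h4
  refine ⟨F a a b b, F a b b a, fun x₀ x₁ x₂ x₃ => ?_⟩
  by_cases h01 : x₀ = x₁
  · subst h01
    by_cases h23 : x₂ = x₃
    · subst h23
      by_cases h02 : x₀ = x₂
      · subst h02; simp [hdiag4, hfour]
      · simp [h02, (hoff h02).1]
    · rw [hzero (by grind)]; grind
  · by_cases h : x₀ = x₃ ∧ x₁ = x₂
    · obtain ⟨rfl, rfl⟩ := h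
      simp [h01, (hoff h01).2]
    · rw [hzero (by grind)]; simp [h01, h]

/-! ### Fourth moments of a Haar unitary -/

/-- Fourth moment `𝔼 u_{x₀y₀} ū_{x₁y₁} u_{x₂y₂} ū_{x₃y₃}` of the entries of a Haar unitary. -/
noncomputable def fourthMoment (q : ℕ) (x y : Fin 4 → Fin q × Fin q) : ℂ :=
  ∫ u : Gate q, u.val (x 0) (y 0) * star (u.val (x 1) (y 1)) *
    (u.val (x 2) (y 2) * star (u.val (x 3) (y 3))) ∂cue q

lemma continuous_gate_entry {q : ℕ} (i j : Fin q × Fin q) :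
    Continuous fun u : Gate q => u.val i j :=
  (continuous_apply j).comp ((continuous_apply i).comp continuous_subtype_val)

lemma integrable_of_continuous_gate {q : ℕ} {f : Gate q → ℂ} (hf : Continuous f) :
    Integrable f (cue q) :=
  hf.integrable_of_hasCompactSupport (HasCompactSupport.of_compactSpace f)

lemma continuous_fourfold {q : ℕ} (x y : Fin 4 → Fin q × Fin q) :
    Continuous fun u : Gate q => u.val (x 0) (y 0) * star (u.val (x 1) (y 1)) *
      (u.val (x 2) (y 2) * star (u.val (x 3) (y 3))) :=
  ((continuous_gate_entry _ _).mul (continuous_gate_entry _ _).star).mul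
    ((continuous_gate_entry _ _).mul (continuous_gate_entry _ _).star)

instance cue_isMulLeftInvariant (q : ℕ) : (cue q).IsMulLeftInvariant := by
  unfold cue
  infer_instance

lemma fourthMoment_invariant {q : ℕ} (y : Fin 4 → Fin q × Fin q)
    (g : Matrix (Fin q × Fin q) (Fin q × Fin q) ℂ) (hg : g ∈ Matrix.unitaryGroup _ ℂ)
    (x₀ x₁ x₂ x₃ : Fin q × Fin q) :
    fourthMoment q ![x₀, x₁, x₂, x₃] y = ∑ l₀, ∑ l₁, ∑ l₂, ∑ l₃,
      g x₀ l₀ * star (g x₁ l₁) * (g x₂ l₂ * star (g x₃ l₃)) *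
        fourthMoment q ![l₀, l₁, l₂, l₃] y := by
  have h := integral_mul_left_eq_self (μ := cue q) (fun u : Gate q =>
    u.val x₀ (y 0) * star (u.val x₁ (y 1)) * (u.val x₂ (y 2) * star (u.val x₃ (y 3)))) ⟨g, hg⟩
  have hint : ∀ l₀ l₁ l₂ l₃, Integrable (fun u : Gate q =>
      g x₀ l₀ * star (g x₁ l₁) * (g x₂ l₂ * star (g x₃ l₃)) *
        (u.val l₀ (y 0) * star (u.val l₁ (y 1)) * (u.val l₂ (y 2) * star (u.val l₃ (y 3)))))
      (cue q) := fun l₀ l₁ l₂ l₃ =>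
    (integrable_of_continuous_gate (continuous_fourfold ![l₀, l₁, l₂, l₃] y)).const_mul _
  calc fourthMoment q ![x₀, x₁, x₂, x₃] y
      = ∫ u : Gate q, (∑ l₀, ∑ l₁, ∑ l₂, ∑ l₃,
          g x₀ l₀ * star (g x₁ l₁) * (g x₂ l₂ * star (g x₃ l₃)) *
          (u.val l₀ (y 0) * star (u.val l₁ (y 1)) *
            (u.val l₂ (y 2) * star (u.val l₃ (y 3))))) ∂cue q := by
        rw [fourthMoment]
        refine h.symm.trans (integral_congr_ae (Filter.Eventually.of_forall fun u => ?_))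
        simp only [Submonoid.coe_mul, Matrix.mul_apply, star_sum, star_mul']
        rw [Finset.sum_mul_sum, Finset.sum_mul_sum]
        simp only [Finset.sum_mul]
        simp only [Finset.mul_sum]
        refine Finset.sum_congr rfl fun _ _ => Finset.sum_congr rfl fun _ _ =>
          Finset.sum_congr rfl fun _ _ => Finset.sum_congr rfl fun _ _ => ?_
        ring
    _ = _ := by
        rw [integral_finsetSum _ fun _ _ => integrable_finsetSum _ fun _ _ =>
          integrable_finsetSum _ fun _ _ => integrable_finsetSum _ fun _ _ => hint _ _ _ _]
        refine Finset.sum_congr rfl fun _ _ => ?_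
        rw [integral_finsetSum _ fun _ _ =>
          integrable_finsetSum _ fun _ _ => integrable_finsetSum _ fun _ _ => hint _ _ _ _]
        refine Finset.sum_congr rfl fun _ _ => ?_
        rw [integral_finsetSum _ fun _ _ => integrable_finsetSum _ fun _ _ => hint _ _ _ _]
        refine Finset.sum_congr rfl fun _ _ => ?_
        rw [integral_finsetSum _ fun _ _ => hint _ _ _ _]
        refine Finset.sum_congr rfl fun _ _ => ?_
        rw [integral_const_mul]
        rfl

lemma sum_entry_mul_star {q : ℕ} (u : Gate q) (i j : Fin q × Fin q) :
    ∑ x, u.val x i * star (u.val x j) = if i = j then 1 else 0 := by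
  have h := congrFun (congrFun (Matrix.mem_unitaryGroup_iff'.1 u.2) j) i
  simp only [Matrix.mul_apply, Matrix.star_apply, Matrix.one_apply] at h
  rw [← Finset.sum_congr rfl fun x _ => mul_comm (star (u.val x j)) (u.val x i), h]
  simp [eq_comm]

lemma sum_fourthMoment_left {q : ℕ} (y : Fin 4 → Fin q × Fin q) :
    ∑ a, ∑ b, fourthMoment q ![a, a, b, b] y =
      if y 0 = y 1 ∧ y 2 = y 3 then 1 else 0 := by
  have hint : ∀ a b, Integrable (fun u : Gate q =>
      u.val a (y 0) * star (u.val a (y 1)) * (u.val b (y 2) * star (u.val b (y 3)))) (cue q) :=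
    fun a b => integrable_of_continuous_gate (continuous_fourfold ![a, a, b, b] y)
  simp only [fourthMoment, Matrix.cons_val]
  simp_rw [← integral_finsetSum Finset.univ fun b _ => hint _ b]
  rw [← integral_finsetSum Finset.univ fun a _ => integrable_finsetSum _ fun b _ => hint a b]
  simp_rw [← Finset.sum_mul_sum, sum_entry_mul_star]
  split_ifs <;> simp_all

lemma sum_fourthMoment_right {q : ℕ} (y : Fin 4 → Fin q × Fin q) :
    ∑ a, ∑ b, fourthMoment q ![a, b, b, a] y =
      if y 0 = y 3 ∧ y 1 = y 2 then 1 else 0 := by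
  have := sum_fourthMoment_left ![y 0, y 3, y 2, y 1]
  simp only [Matrix.cons_val] at this
  refine Eq.trans ?_ (this.trans (if_congr (and_congr_right' eq_comm) rfl rfl))
  refine Finset.sum_congr rfl fun _ _ => Finset.sum_congr rfl fun _ _ => ?_
  simp only [fourthMoment, Matrix.cons_val]
  congr 1
  ext u
  ring

/-- The second-order Weingarten formula in dimension `d = q²`. -/
theorem fourthMoment_eq {q : ℕ} (hq : 2 ≤ q) (x y : Fin 4 → Fin q × Fin q) :
    fourthMoment q x y = (((q : ℂ) ^ 2) ^ 2 * (((q : ℂ) ^ 2) ^ 2 - 1))⁻¹ * (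
      ((q : ℂ) ^ 2 * ((q : ℂ) ^ 2 * (if y 0 = y 1 ∧ y 2 = y 3 then 1 else 0)
          - (if y 0 = y 3 ∧ y 1 = y 2 then 1 else 0)))
        * (if x 0 = x 1 ∧ x 2 = x 3 then 1 else 0) +
      ((q : ℂ) ^ 2 * ((q : ℂ) ^ 2 * (if y 0 = y 3 ∧ y 1 = y 2 then 1 else 0)
          - (if y 0 = y 1 ∧ y 2 = y 3 then 1 else 0)))
        * (if x 0 = x 3 ∧ x 1 = x 2 then 1 else 0)) := by
  have : NeZero q := ⟨by omega⟩
  have : Nontrivial (Fin q) := Fin.nontrivial_iff_two_le.2 hq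
  obtain ⟨α, β, h⟩ := exists_pairing_of_invariant
    (fun x₀ x₁ x₂ x₃ => fourthMoment q ![x₀, x₁, x₂, x₃] y)
    (fun g hg x₀ x₁ x₂ x₃ => fourthMoment_invariant y g hg x₀ x₁ x₂ x₃)
  have h1 := sum_fourthMoment_left y
  have h2 := sum_fourthMoment_right y
  simp only [h] at h1 h2
  have hsymm : ∀ a b : Fin q × Fin q, (a = b ∧ b = a) ↔ a = b := fun a b => by grind
  simp only [and_self, hsymm, mul_ite, mul_one, mul_zero, Finset.sum_add_distrib, if_true,
    Finset.sum_const, Finset.sum_ite_eq, Finset.mem_univ, Finset.card_univ, Fintype.card_prod,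
    Fintype.card_fin, nsmul_eq_mul, Nat.cast_mul] at h1 h2
  have hx : x = ![x 0, x 1, x 2, x 3] := List.ofFn_inj.mp rfl
  have hq4 : ((q : ℂ) ^ 2) ^ 2 * (((q : ℂ) ^ 2) ^ 2 - 1) ≠ 0 := by
    have h16 : (16 : ℝ) ≤ ((q : ℝ) ^ 2) ^ 2 := by
      have : (2 : ℝ) ≤ q := by exact_mod_cast hq
      have h4 := pow_le_pow_left₀ (by norm_num) this 4
      norm_num [← pow_mul] at h4 ⊢
      exact h4
    have : ((q : ℝ) ^ 2) ^ 2 * (((q : ℝ) ^ 2) ^ 2 - 1) ≠ 0 := by nlinarith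
    exact_mod_cast this
  have hα : ((q : ℂ) ^ 2) ^ 2 * (((q : ℂ) ^ 2) ^ 2 - 1) * α = (q : ℂ) ^ 2 * ((q : ℂ) ^ 2 *
      (if y 0 = y 1 ∧ y 2 = y 3 then 1 else 0) - (if y 0 = y 3 ∧ y 1 = y 2 then 1 else 0)) := by
    rw [← h1, ← h2]; ring
  have hβ : ((q : ℂ) ^ 2) ^ 2 * (((q : ℂ) ^ 2) ^ 2 - 1) * β = (q : ℂ) ^ 2 * ((q : ℂ) ^ 2 *
      (if y 0 = y 3 ∧ y 1 = y 2 then 1 else 0) - (if y 0 = y 1 ∧ y 2 = y 3 then 1 else 0)) := by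
    rw [← h1, ← h2]; ring
  rw [← hα, ← hβ, mul_assoc _ α, mul_assoc _ β, ← mul_add, inv_mul_cancel_left₀ hq4, ← h, ← hx]

/-! ### Sums over tuples -/

lemma sum_fin_cons {α M : Type*} [Fintype α] [AddCommMonoid M] {n : ℕ}
    (f : (Fin (n + 1) → α) → M) :
    ∑ σ, f σ = ∑ a, ∑ ρ : Fin n → α, f (Fin.cons a ρ) := by
  rw [← (Fin.consEquiv fun _ => α).sum_comp, Fintype.sum_prod_type]
  rfl

lemma sum_fin_snoc {α M : Type*} [Fintype α] [AddCommMonoid M] {n : ℕ}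
    (f : (Fin (n + 1) → α) → M) :
    ∑ σ, f σ = ∑ ρ : Fin n → α, ∑ a, f (Fin.snoc ρ a) := by
  rw [← (Fin.snocEquiv fun _ => α).sum_comp, Fintype.sum_prod_type, Finset.sum_comm]
  rfl

lemma sum_fin_four {α M : Type*} [Fintype α] [AddCommMonoid M] (f : α → α → α → α → M) :
    ∑ s : Fin 4 → α, f (s 0) (s 1) (s 2) (s 3) = ∑ a, ∑ b, ∑ c, ∑ d, f a b c d := by
  simp only [sum_fin_cons, Finset.univ_unique, Finset.sum_singleton]
  rfl

/-! ### Pairing states and the averaged gate -/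

/-- The two pairing states, `ket0` for `false` and `ket1` for `true`. -/
noncomputable def pairing (q : ℕ) (b : Bool) : Site q → ℂ := bif b then ket1 q else ket0 q

/-- The overlap of two pairing states: `q` if they agree and `1` otherwise. -/
def overlap (q : ℕ) (a b : Bool) : ℂ := if a = b then q else 1

lemma inv_sqrt_mul_self (q : ℕ) :
    ((1 / √(q : ℝ) : ℝ) : ℂ) * ((1 / √(q : ℝ) : ℝ) : ℂ) = (q : ℂ)⁻¹ := by
  rw [← Complex.ofReal_mul, div_mul_div_comm, Real.mul_self_sqrt (by positivity)]
  simp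

lemma pairing_mul_pairing_false {q : ℕ} (a b : Site q) :
    pairing q false a * pairing q false b = (q : ℂ)⁻¹ *
      if (a 0, b 0) = (a 1, b 1) ∧ (a 2, b 2) = (a 3, b 3) then 1 else 0 := by
  rw [← inv_sqrt_mul_self]
  simp only [pairing, cond_false, ket0, Prod.mk.injEq]
  split_ifs <;> simp_all

lemma pairing_mul_pairing_true {q : ℕ} (a b : Site q) :
    pairing q true a * pairing q true b = (q : ℂ)⁻¹ *
      if (a 0, b 0) = (a 3, b 3) ∧ (a 1, b 1) = (a 2, b 2) then 1 else 0 := by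
  rw [← inv_sqrt_mul_self]
  simp only [pairing, cond_true, ket1, Prod.mk.injEq]
  split_ifs <;> simp_all

lemma sum_pairing_mul_pairing {q : ℕ} (hq : 2 ≤ q) (a b : Bool) :
    ∑ s, pairing q a s * pairing q b s = overlap q a b := by
  have hq0 : (q : ℂ) ≠ 0 := by exact_mod_cast (by omega : q ≠ 0)
  have hr := inv_sqrt_mul_self q
  cases a <;> cases b <;>
    simp only [pairing, cond_true, cond_false, ket0, ket1, overlap, ite_mul, mul_ite, zero_mul,
      mul_zero, hr, if_true, reduceCtorEq, if_false]
  · rw [sum_fin_four fun a b c d => if a = b ∧ c = d then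
      (if a = b ∧ c = d then (q : ℂ)⁻¹ else 0) else 0]
    simp [ite_and, hq0]
  · rw [sum_fin_four fun a b c d => if a = d ∧ b = c then
      (if a = b ∧ c = d then (q : ℂ)⁻¹ else 0) else 0]
    simp [ite_and, hq0]
  · rw [sum_fin_four fun a b c d => if a = b ∧ c = d then
      (if a = d ∧ b = c then (q : ℂ)⁻¹ else 0) else 0]
    simp [ite_and, hq0]
  · rw [sum_fin_four fun a b c d => if a = d ∧ b = c then
      (if a = d ∧ b = c then (q : ℂ)⁻¹ else 0) else 0]
    simp [ite_and, hq0]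

/-- The entry of the averaged replicated gate `𝔼 u ⊗ ū ⊗ u ⊗ ū`. -/
noncomputable def avgGate (q : ℕ) (a' b' a b : Site q) : ℂ :=
  ∫ u, replicatedGate u a' b' a b ∂cue q

/-- The Weingarten matrix, the inverse of the Gram matrix of the two pairing states of a pair of
legs. -/
noncomputable def weingarten (q : ℕ) (s t : Bool) : ℂ :=
  if s = t then (q : ℂ) ^ 2 / ((q : ℂ) ^ 4 - 1) else -1 / ((q : ℂ) ^ 4 - 1)

lemma pow_four_sub_one_ne_zero {q : ℕ} (hq : 2 ≤ q) : (q : ℂ) ^ 4 - 1 ≠ 0 := by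
  rw [sub_ne_zero]
  exact_mod_cast (Nat.one_lt_pow (by norm_num) (by omega : 1 < q)).ne'

lemma avgGate_eq {q : ℕ} (hq : 2 ≤ q) (a' b' a b : Site q) :
    avgGate q a' b' a b = ∑ s, ∑ t, weingarten q s t *
      (pairing q s a' * pairing q s b') * (pairing q t a * pairing q t b) := by
  have hq0 : (q : ℂ) ≠ 0 := by exact_mod_cast (by omega : q ≠ 0)
  have hq4 := pow_four_sub_one_ne_zero hq
  have hq4' : ((q : ℂ) ^ 2) ^ 2 - 1 ≠ 0 := by rwa [← pow_mul]
  have h := fourthMoment_eq hq (fun k => (a' k, b' k)) (fun k => (a k, b k))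
  refine (show avgGate q a' b' a b = _ from h).trans ?_
  simp only [Fintype.sum_bool, pairing_mul_pairing_false, pairing_mul_pairing_true, weingarten,
    if_true, reduceCtorEq, if_false]
  generalize (if (a' 0, b' 0) = (a' 1, b' 1) ∧ (a' 2, b' 2) = (a' 3, b' 3)
    then (1 : ℂ) else 0) = x
  generalize (if (a' 0, b' 0) = (a' 3, b' 3) ∧ (a' 1, b' 1) = (a' 2, b' 2)
    then (1 : ℂ) else 0) = x'
  generalize (if (a 0, b 0) = (a 1, b 1) ∧ (a 2, b 2) = (a 3, b 3) then (1 : ℂ) else 0) = y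
  generalize (if (a 0, b 0) = (a 3, b 3) ∧ (a 1, b 1) = (a 2, b 2) then (1 : ℂ) else 0) = y'
  field_simp
  ring

/-- The averaged gate is symmetric under exchanging the two input legs with the two output legs
and left with right. -/
lemma avgGate_symm {q : ℕ} (hq : 2 ≤ q) (a' b' a b : Site q) :
    avgGate q a' b' a b = avgGate q b a b' a' := by
  simp only [avgGate_eq hq, Fintype.sum_bool, weingarten, if_true, reduceCtorEq, if_false]
  ring

/-- The weight of a domain wall in the averaged gate. -/
noncomputable def kap (q : ℕ) : ℂ := (q : ℂ) / ((q : ℂ) ^ 2 + 1)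

lemma sq_add_one_ne_zero (q : ℕ) : (q : ℂ) ^ 2 + 1 ≠ 0 := by
  exact_mod_cast (by positivity : q ^ 2 + 1 ≠ 0)

/-- The averaged gate maps `|m t⟩` to `∑ s, stepWeight q m t s • |s s⟩`. -/
noncomputable def stepWeight (q : ℕ) (m t s : Bool) : ℂ :=
  if m = t then (if s = m then 1 else 0) else kap q

lemma sum_weingarten_overlap {q : ℕ} (hq : 2 ≤ q) (m t s : Bool) :
    ∑ r, weingarten q s r * (overlap q r m * overlap q r t) = stepWeight q m t s := by
  have h1 := pow_four_sub_one_ne_zero hq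
  have h2 := sq_add_one_ne_zero q
  cases m <;> cases t <;> cases s <;>
    simp [weingarten, overlap, stepWeight, kap] <;> field_simp <;> ring

lemma avgGate_apply_pairing {q : ℕ} (hq : 2 ≤ q) (m t : Bool) (a' b' : Site q) :
    ∑ a, ∑ b, avgGate q a' b' a b * (pairing q m a * pairing q t b) =
      ∑ s, stepWeight q m t s * (pairing q s a' * pairing q s b') := by
  have h : ∀ a b : Site q, avgGate q a' b' a b * (pairing q m a * pairing q t b) =
      ∑ s, ∑ r, weingarten q s r * (pairing q s a' * pairing q s b') *
        ((pairing q r a * pairing q m a) * (pairing q r b * pairing q t b)) := fun a b => by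
    rw [avgGate_eq hq, Finset.sum_mul]
    refine Finset.sum_congr rfl fun s _ => ?_
    rw [Finset.sum_mul]
    exact Finset.sum_congr rfl fun r _ => by ring
  simp only [h]
  calc _ = ∑ s, ∑ r, ∑ a, ∑ b, weingarten q s r * (pairing q s a' * pairing q s b') *
        ((pairing q r a * pairing q m a) * (pairing q r b * pairing q t b)) := by
        simp only [Fintype.sum_bool, Finset.sum_add_distrib]
    _ = _ := by
        refine Finset.sum_congr rfl fun s _ => ?_
        rw [← sum_weingarten_overlap hq, Finset.sum_mul]
        refine Finset.sum_congr rfl fun r _ => ?_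
        simp only [← Finset.mul_sum, ← Finset.sum_mul, sum_pairing_mul_pairing hq]
        ring

/-! ### The averaged generator as a chain of averaged gates -/

/-- The entry of a chain of averaged gates whose auxiliary leg starts in `f` and ends in `g`. -/
noncomputable def chain (q : ℕ) {w : ℕ} (f g : Site q → ℂ) (i j : Config q w) : ℂ :=
  ∑ μ : Fin (w + 1) → Site q,
    f (μ 0) * (∏ k : Fin w, avgGate q (i k) (μ k.succ) (μ k.castSucc) (j k)) * g (μ (Fin.last w))

lemma continuous_replicatedGate {q : ℕ} (a' b' a b : Site q) :
    Continuous fun u : Gate q => replicatedGate u a' b' a b :=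
  continuous_fourfold (fun k => (a' k, b' k)) (fun k => (a k, b k))

lemma llgMatrix_apply {q w : ℕ} (i j : Config q w) :
    llgMatrix q w i j = chain q (ket0 q) (ket1 q) i j := by
  simp only [llgMatrix, llgOfGates, Matrix.of_apply, chain]
  rw [integral_finsetSum _ fun μ _ => ((Integrable.fintype_prod
    (f := fun k u => replicatedGate u (i k) (μ k.succ) (μ k.castSucc) (j k)) fun k =>
      integrable_of_continuous_gate (continuous_replicatedGate _ _ _ _)).const_mul _).mul_const _]
  refine Finset.sum_congr rfl fun μ _ => ?_
  rw [integral_mul_const, integral_const_mul, integral_fintype_prod_eq_prod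
    (f := fun k u => replicatedGate u (i k) (μ k.succ) (μ k.castSucc) (j k))]
  rfl

lemma chain_zero {q : ℕ} (f g : Site q → ℂ) (i j : Config q 0) :
    chain q f g i j = ∑ ν, f ν * g ν := by
  simp only [chain, Finset.univ_eq_empty, Finset.prod_empty, mul_one]
  exact (Equiv.funUnique (Fin 1) (Site q)).sum_comp fun ν => f ν * g ν

lemma chain_succ {q w : ℕ} (f g : Site q → ℂ) (i j : Config q (w + 1)) :
    chain q f g i j = chain q (fun ν => ∑ a, f a * avgGate q (i 0) ν a (j 0)) g
      (Fin.tail i) (Fin.tail j) := by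
  rw [chain, sum_fin_cons, Finset.sum_comm, chain]
  refine Finset.sum_congr rfl fun μ _ => ?_
  rw [Finset.sum_mul, Finset.sum_mul]
  refine Finset.sum_congr rfl fun a _ => ?_
  rw [Fin.prod_univ_succ, Fin.cons_zero, ← Fin.succ_last, Fin.cons_succ, Fin.cons_succ,
    Fin.castSucc_zero, Fin.cons_zero, ← mul_assoc]
  rfl

lemma chain_sum_mul {q w : ℕ} {ι : Type*} (s : Finset ι) (c : ι → ℂ) (f : ι → Site q → ℂ)
    (g : Site q → ℂ) (i j : Config q w) :
    chain q (fun ν => ∑ x ∈ s, c x * f x ν) g i j = ∑ x ∈ s, c x * chain q (f x) g i j := by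
  simp only [chain, Finset.mul_sum, Finset.sum_mul]
  rw [Finset.sum_comm]
  exact Finset.sum_congr rfl fun _ _ => Finset.sum_congr rfl fun _ _ => by ring

/-- Reading the chain from its other end exchanges inputs with outputs. -/
lemma chain_rev {q w : ℕ} (hq : 2 ≤ q) (f g : Site q → ℂ) (i j : Config q w) :
    chain q f g i j = chain q g f (j ∘ Fin.rev) (i ∘ Fin.rev) := by
  simp only [chain]
  rw [← (Equiv.arrowCongr Fin.revPerm (Equiv.refl (Site q))).sum_comp]
  refine Finset.sum_congr rfl fun μ _ => ?_
  simp only [Equiv.arrowCongr_apply, Equiv.coe_refl, Function.comp_apply,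
    Fin.revPerm_symm, Fin.revPerm_apply, Fin.rev_zero, Fin.rev_last, id_eq]
  rw [← Equiv.prod_comp Fin.revPerm]
  simp only [Fin.revPerm_apply, Fin.rev_rev, Fin.rev_succ, Fin.rev_castSucc]
  simp only [fun k : Fin w => avgGate_symm hq (i k.rev)]
  ring

/-- The vector `|τ₁ … τ_w⟩` of pairing states. -/
noncomputable def pairingWord (q : ℕ) {w : ℕ} (τ : Fin w → Bool) (i : Config q w) : ℂ :=
  ∏ k, pairing q (τ k) (i k)

lemma pairingWord_cons {q w : ℕ} (t : Bool) (τ : Fin w → Bool) (i : Config q (w + 1)) :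
    pairingWord q (Fin.cons t τ : Fin (w + 1) → Bool) i =
      pairing q t (i 0) * pairingWord q τ (Fin.tail i) := by
  rw [pairingWord, Fin.prod_univ_succ]
  rfl

/-- The weight with which the chain, entered in the pairing state `m` and left with final weights
`g`, maps the word `τ` to the word `σ`: after each gate the auxiliary leg carries the same pairing
as the site just produced. -/
noncomputable def wordWeight (q : ℕ) (g : Bool → ℂ) :
    (w : ℕ) → Bool → (Fin w → Bool) → (Fin w → Bool) → ℂ
  | 0, m, _, _ => g m
  | w + 1, m, τ, σ =>
    stepWeight q m (τ 0) (σ 0) * wordWeight q g w (σ 0) (Fin.tail τ) (Fin.tail σ)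

theorem sum_chain_mul_pairingWord {q : ℕ} (hq : 2 ≤ q) (n : Bool) : ∀ {w : ℕ} (m : Bool)
    (τ : Fin w → Bool) (i : Config q w),
    ∑ j, chain q (pairing q m) (pairing q n) i j * pairingWord q τ j =
      ∑ σ, wordWeight q (overlap q n) w m τ σ * pairingWord q σ i := by
  intro w
  induction w with
  | zero =>
    intro m τ i
    simp only [Finset.univ_unique, Finset.sum_singleton, chain_zero, sum_pairing_mul_pairing hq,
      wordWeight, pairingWord, Finset.univ_eq_empty, Finset.prod_empty, mul_one]
    simp [overlap, eq_comm]
  | succ w ih =>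
    intro m τ i
    have hstep : ∀ j' : Config q w, ∑ b, chain q (pairing q m) (pairing q n) i (Fin.cons b j') *
        pairing q (τ 0) b = ∑ s, stepWeight q m (τ 0) s * pairing q s (i 0) *
          chain q (pairing q s) (pairing q n) (Fin.tail i) j' := by
      intro j'
      rw [← chain_sum_mul]
      simp only [chain_succ, Fin.cons_zero, Fin.tail_cons]
      calc _ = ∑ b, pairing q (τ 0) b * chain q
              (fun ν => ∑ a, pairing q m a * avgGate q (i 0) ν a b) (pairing q n)
              (Fin.tail i) j' := Finset.sum_congr rfl fun _ _ => mul_comm _ _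
        _ = _ := by
            rw [← chain_sum_mul]
            congr 1
            ext ν
            simp only [Finset.mul_sum]
            rw [Finset.sum_comm]
            have := avgGate_apply_pairing hq m (τ 0) (i 0) ν
            calc _ = _ := Finset.sum_congr rfl fun a _ => Finset.sum_congr rfl fun b _ => by ring
              _ = _ := this
              _ = _ := Finset.sum_congr rfl fun s _ => by ring
    have hτ : τ = Fin.cons (τ 0) (Fin.tail τ) := (Fin.cons_self_tail τ).symm
    have hword : ∀ b (j' : Config q w), pairingWord q τ (Fin.cons b j') =
        pairing q (τ 0) b * pairingWord q (Fin.tail τ) j' := by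
      intro b j'
      conv_lhs => rw [hτ, pairingWord_cons]
      rfl
    rw [sum_fin_cons, Finset.sum_comm, sum_fin_cons]
    simp only [hword, ← mul_assoc, ← Finset.sum_mul, hstep, pairingWord_cons, wordWeight,
      Fin.cons_zero, Fin.tail_cons]
    simp only [Finset.sum_mul]
    rw [Finset.sum_comm]
    refine Finset.sum_congr rfl fun s _ => ?_
    simp only [mul_assoc]
    rw [← Finset.mul_sum, ← Finset.mul_sum, ih, Finset.mul_sum, Finset.mul_sum]
    exact Finset.sum_congr rfl fun _ _ => by ring

/-- The columns of a chain are combinations of words of pairing states. -/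
lemma exists_chain_eq_sum {q : ℕ} (hq : 2 ≤ q) (g : Site q → ℂ) : ∀ {w : ℕ} (f : Site q → ℂ)
    (j : Config q w), ∃ c : (Fin w → Bool) → ℂ, ∀ i,
      chain q f g i j = ∑ σ, c σ * pairingWord q σ i := by
  intro w
  induction w with
  | zero =>
    intro f j
    refine ⟨fun _ => ∑ ν, f ν * g ν, fun i => ?_⟩
    simp [chain_zero, pairingWord]
  | succ w ih =>
    intro f j
    choose c hc using fun s => ih (pairing q s) (Fin.tail j)
    refine ⟨fun σ => (∑ t, weingarten q (σ 0) t * (∑ a, f a * pairing q t a) *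
      pairing q t (j 0)) * c (σ 0) (Fin.tail σ), fun i => ?_⟩
    have : (fun ν => ∑ a, f a * avgGate q (i 0) ν a (j 0)) = fun ν => ∑ s,
        ((∑ t, weingarten q s t * (∑ a, f a * pairing q t a) * pairing q t (j 0)) *
          pairing q s (i 0)) * pairing q s ν := by
      ext ν
      simp only [avgGate_eq hq, Fintype.sum_bool, Finset.mul_sum, Finset.sum_mul,
        ← Finset.sum_add_distrib]
      exact Finset.sum_congr rfl fun a _ => by ring
    rw [chain_succ, this, chain_sum_mul, sum_fin_cons]
    refine Finset.sum_congr rfl fun s _ => ?_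
    rw [hc, Finset.mul_sum]
    refine Finset.sum_congr rfl fun ρ _ => ?_
    simp only [pairingWord_cons, Fin.cons_zero, Fin.tail_cons]
    ring

/-! ### Spectral bound for the word weights -/

lemma wordWeight_snoc (q : ℕ) (g : Bool → ℂ) (t s : Bool) : ∀ {n : ℕ} (m : Bool)
    (τ σ : Fin n → Bool), wordWeight q g (n + 1) m (Fin.snoc τ t) (Fin.snoc σ s) =
      wordWeight q (fun a => stepWeight q a t s * g s) n m τ σ := by
  intro n
  induction n with
  | zero =>
    intro m τ σ
    rfl
  | succ n ih =>
    intro m τ σ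
    have h : ∀ (ρ : Fin (n + 1) → Bool) (b : Bool),
        (Fin.snoc ρ b : Fin (n + 2) → Bool) = Fin.cons (ρ 0) (Fin.snoc (Fin.tail ρ) b) := by
      intro ρ b
      rw [Fin.cons_snoc_eq_snoc_cons, Fin.cons_self_tail]
    rw [wordWeight, h, h]
    simp only [Fin.cons_zero, Fin.tail_cons]
    rw [ih, wordWeight]

lemma wordWeight_linear (q : ℕ) (x y : ℂ) (g h : Bool → ℂ) : ∀ {n : ℕ} (m : Bool)
    (τ σ : Fin n → Bool), wordWeight q (fun a => x * g a + y * h a) n m τ σ =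
      x * wordWeight q g n m τ σ + y * wordWeight q h n m τ σ := by
  intro n
  induction n with
  | zero => intro m τ σ; rfl
  | succ n ih => intro m τ σ; simp only [wordWeight, ih]; ring

lemma wordWeight_const_mul (q : ℕ) (x : ℂ) (g : Bool → ℂ) {n : ℕ} (m : Bool)
    (τ σ : Fin n → Bool) : wordWeight q (fun a => x * g a) n m τ σ =
      x * wordWeight q g n m τ σ := by
  simpa using wordWeight_linear q x 0 g g m τ σ

lemma norm_kap (q : ℕ) : ‖kap q‖ = (q : ℝ) / ((q : ℝ) ^ 2 + 1) := by
  have : kap q = (((q : ℝ) / ((q : ℝ) ^ 2 + 1) : ℝ) : ℂ) := by simp [kap]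
  rw [this, Complex.norm_real, Real.norm_of_nonneg (by positivity)]

lemma sum_norm_stepWeight_le (q : ℕ) (m t : Bool) : ∑ s, ‖stepWeight q m t s‖ ≤ 1 := by
  have h : 2 * ‖kap q‖ ≤ 1 := by
    rw [norm_kap, mul_div_assoc', div_le_one (by positivity)]
    nlinarith [sq_nonneg ((q : ℝ) - 1)]
  cases m <;> cases t <;> simp [stepWeight] <;> linarith

/-- Every gate has column sums at most one, so only the final weight counts. -/
lemma sum_norm_wordWeight_le (q : ℕ) {g : Bool → ℂ} {C : ℝ} (hg : ∀ a, ‖g a‖ ≤ C) :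
    ∀ {n : ℕ} (m : Bool) (τ : Fin n → Bool), ∑ σ, ‖wordWeight q g n m τ σ‖ ≤ C := by
  have hC : 0 ≤ C := (norm_nonneg _).trans (hg true)
  intro n
  induction n with
  | zero => intro m τ; simpa [wordWeight] using hg m
  | succ n ih =>
    intro m τ
    rw [sum_fin_cons]
    simp only [wordWeight, Fin.cons_zero, Fin.tail_cons, norm_mul, ← Finset.mul_sum]
    calc _ ≤ ∑ s, ‖stepWeight q m (τ 0) s‖ * C :=
          Finset.sum_le_sum fun s _ => mul_le_mul_of_nonneg_left (ih _ _) (norm_nonneg _)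
      _ ≤ C := by
          rw [← Finset.sum_mul]
          exact mul_le_of_le_one_left hC (sum_norm_stepWeight_le q m (τ 0))

/-- Eigenvalue bound from column sums. -/
lemma norm_le_of_column_sums {ι : Type*} [Fintype ι] {M : ι → ι → ℂ} {C : ℝ}
    (hM : ∀ τ, ∑ σ, ‖M τ σ‖ ≤ C) {c : ι → ℂ} (hc : c ≠ 0) {z : ℂ}
    (h : ∀ σ, z * c σ = ∑ τ, M τ σ * c τ) : ‖z‖ ≤ C := by
  have hpos : 0 < ∑ σ, ‖c σ‖ := by
    obtain ⟨σ, hσ⟩ := Function.ne_iff.1 hc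
    exact Finset.sum_pos' (fun _ _ => norm_nonneg _) ⟨σ, Finset.mem_univ _, norm_pos_iff.2 hσ⟩
  refine le_of_mul_le_mul_right ?_ hpos
  calc ‖z‖ * ∑ σ, ‖c σ‖ = ∑ σ, ‖∑ τ, M τ σ * c τ‖ := by
        rw [Finset.mul_sum]
        exact Finset.sum_congr rfl fun σ _ => by rw [← h, norm_mul]
    _ ≤ ∑ σ, ∑ τ, ‖M τ σ‖ * ‖c τ‖ := Finset.sum_le_sum fun σ _ =>
        (norm_sum_le _ _).trans_eq (Finset.sum_congr rfl fun τ _ => norm_mul _ _)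
    _ = ∑ τ, (∑ σ, ‖M τ σ‖) * ‖c τ‖ := by
        rw [Finset.sum_comm]
        exact Finset.sum_congr rfl fun τ _ => (Finset.sum_mul _ _ _).symm
    _ ≤ ∑ τ, C * ‖c τ‖ := Finset.sum_le_sum fun τ _ =>
        mul_le_mul_of_nonneg_right (hM τ) (norm_nonneg _)
    _ = _ := (Finset.mul_sum _ _ _).symm

/-- Contracting the last site with `⟨1|` commutes with the chain: this is the unitarity of the
last gate. -/
lemma sum_overlap_mul_wordWeight_snoc (q : ℕ) (t : Bool) {n : ℕ} (m : Bool)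
    (τ σ : Fin n → Bool) :
    ∑ s, overlap q true s *
        wordWeight q (overlap q true) (n + 1) m (Fin.snoc τ t) (Fin.snoc σ s) =
      overlap q true t * wordWeight q (overlap q true) n m τ σ := by
  simp only [wordWeight_snoc, Fintype.sum_bool]
  rw [← wordWeight_linear, ← wordWeight_const_mul]
  congr 1
  ext a
  have := sq_add_one_ne_zero q
  cases a <;> cases t <;> simp [stepWeight, overlap, kap]
  · field_simp
  · field_simp

/-- Eigenvalue bound behind a domain wall: the sites to the right of a `0|1` wall, with the chain
in the state `1`, on vectors orthogonal to `|1 … 1⟩`.  Contract sites from the right with `⟨1|`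
until the result vanishes. -/
lemma norm_le_of_eigen_behind_wall {q : ℕ} (hq : 2 ≤ q) {z : ℂ} : ∀ {n : ℕ}
    {c : (Fin n → Bool) → ℂ}, c ≠ 0 →
    (∀ σ, z * c σ = kap q * ∑ τ, wordWeight q (overlap q true) n true τ σ * c τ) →
    ∑ σ, c σ * ∏ k, overlap q true (σ k) = 0 → ‖z‖ ≤ ‖kap q‖ ^ 2 * q := by
  have hq0 : (q : ℂ) ≠ 0 := by exact_mod_cast (by omega : q ≠ 0)
  intro n
  induction n with
  | zero =>
    intro c hc _ h0
    refine absurd (funext fun σ => ?_) hc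
    simp only [Finset.univ_unique, Finset.sum_singleton, Finset.univ_eq_empty,
      Finset.prod_empty, mul_one] at h0
    exact (congrArg c (Subsingleton.elim σ _)).trans h0
  | succ n ih =>
    intro c hc hz h0
    -- either the contraction of the last site with `⟨1|` vanishes, or it is an eigenvector of the
    -- shorter chain
    by_cases hR : (fun σ : Fin n → Bool => ∑ s, overlap q true s * c (Fin.snoc σ s)) = 0
    · have hsnoc : ∀ σ : Fin n → Bool, c (Fin.snoc σ true) = -(q : ℂ)⁻¹ * c (Fin.snoc σ false) := by
        intro σ
        have := congrFun hR σ
        simp only [Fintype.sum_bool, overlap, if_true, reduceCtorEq, if_false, one_mul,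
          Pi.zero_apply] at this
        field_simp
        linear_combination this
      have hy : (fun σ : Fin n → Bool => c (Fin.snoc σ false)) ≠ 0 := by
        intro hy
        refine hc (funext fun σ => ?_)
        rw [← Fin.snoc_init_self σ]
        have := congrFun hy (Fin.init σ)
        cases σ (Fin.last n)
        · exact this
        · rw [hsnoc]
          simpa using Or.inr this
      -- the last site is then in the state `q|0⟩ - |1⟩`, and compressing the last gate to it
      -- replaces the final weights `⟨1|` by `κ ⟨0|`
      refine norm_le_of_column_sums
        (M := fun τ σ => kap q ^ 2 * wordWeight q (overlap q false) n true τ σ) (fun τ => ?_) hy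
        (fun σ => ?_)
      · simp only [norm_mul, ← Finset.mul_sum, norm_pow]
        refine mul_le_mul_of_nonneg_left
          (sum_norm_wordWeight_le q (fun a => ?_) _ _) (by positivity)
        have : (1 : ℝ) ≤ q := by exact_mod_cast (by omega : 1 ≤ q)
        cases a <;> simp [overlap, this]
      · rw [hz, sum_fin_snoc, Finset.mul_sum]
        refine Finset.sum_congr rfl fun τ _ => ?_
        simp only [Fintype.sum_bool, hsnoc, wordWeight_snoc]
        have : (fun a => kap q * overlap q false a) = fun a =>
            -(q : ℂ)⁻¹ * (stepWeight q a true false * overlap q true false) +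
              1 * (stepWeight q a false false * overlap q true false) := by
          have := sq_add_one_ne_zero q
          ext a
          cases a <;> simp [stepWeight, overlap, kap]
          field_simp
          ring
        have h2 : kap q * wordWeight q (overlap q false) n true τ σ = _ :=
          (wordWeight_const_mul q (kap q) (overlap q false) true τ σ).symm
        rw [this, wordWeight_linear] at h2
        rw [pow_two, mul_assoc (kap q), h2]
        ring
    · refine ih hR (fun σ => ?_) ?_
      · calc z * ∑ s, overlap q true s * c (Fin.snoc σ s)
            = ∑ s, overlap q true s * (z * c (Fin.snoc σ s)) := by
              rw [Finset.mul_sum]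
              exact Finset.sum_congr rfl fun s _ => by ring
          _ = kap q * ∑ τ : Fin n → Bool, ∑ t, (∑ s, overlap q true s *
                wordWeight q (overlap q true) (n + 1) true (Fin.snoc τ t) (Fin.snoc σ s)) *
                c (Fin.snoc τ t) := by
              simp only [hz, sum_fin_snoc (n := n), Fintype.sum_bool, Finset.mul_sum,
                ← Finset.sum_add_distrib]
              exact Finset.sum_congr rfl fun τ _ => by ring
          _ = _ := by
              simp only [sum_overlap_mul_wordWeight_snoc, Finset.mul_sum]
              exact Finset.sum_congr rfl fun τ _ => Finset.sum_congr rfl fun t _ => by ring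
      · rw [← h0, sum_fin_snoc (n := n)]
        refine Finset.sum_congr rfl fun σ _ => ?_
        rw [Finset.sum_mul]
        refine Finset.sum_congr rfl fun s _ => ?_
        simp only [Fin.prod_univ_castSucc, Fin.snoc_castSucc, Fin.snoc_last]
        ring

/-- The word `0^m 1^{w-m}`. -/
def wallWord (w m : ℕ) (k : Fin w) : Bool := decide (m ≤ k)

lemma wallWord_succ_succ (w m : ℕ) :
    wallWord (w + 1) (m + 1) = Fin.cons false (wallWord w m) := by
  ext k
  refine Fin.cases ?_ (fun k => ?_) k <;> simp [wallWord]

lemma wallWord_zero (w : ℕ) : wallWord (w + 1) 0 = Fin.cons true (wallWord w 0) := by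
  ext k
  refine Fin.cases ?_ (fun k => ?_) k <;> simp [wallWord]

/-- Eigenvalue bound for eigenvectors orthogonal to all `|0^m 1^{w-m}⟩`: peel off sites from the
left as long as the vector lies in `|0⟩ ⊗ _`, which the chain preserves. -/
theorem norm_le_of_eigen_orthogonal {q : ℕ} (hq : 2 ≤ q) {z : ℂ} : ∀ {w : ℕ}
    {c : (Fin w → Bool) → ℂ}, c ≠ 0 →
    (∀ σ, z * c σ = ∑ τ, wordWeight q (overlap q true) w false τ σ * c τ) →
    (∀ m ≤ w, ∑ σ, c σ * ∏ k, overlap q (wallWord w m k) (σ k) = 0) →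
    ‖z‖ ≤ ‖kap q‖ ^ 2 * q := by
  have hq0 : (q : ℂ) ≠ 0 := by exact_mod_cast (by omega : q ≠ 0)
  have hq1 : (q : ℂ) ^ 2 - 1 ≠ 0 := by
    rw [sub_ne_zero]
    exact_mod_cast (Nat.one_lt_pow (by norm_num) (by omega : 1 < q)).ne'
  intro w
  induction w with
  | zero =>
    intro c hc _ h0
    refine absurd (funext fun σ => ?_) hc
    have := h0 0 le_rfl
    simp only [Finset.univ_unique, Finset.sum_singleton, Finset.univ_eq_empty,
      Finset.prod_empty, mul_one] at this
    exact (congrArg c (Subsingleton.elim σ _)).trans this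
  | succ w ih =>
    intro c hc hz h0
    -- the components with first site `1` form an eigenvector of `κ` times the chain entered in `1`
    by_cases h1 : (fun σ : Fin w → Bool => c (Fin.cons true σ)) = 0
    · have h1' : ∀ σ : Fin w → Bool, c (Fin.cons true σ) = 0 := congrFun h1
      refine ih (c := fun σ => c (Fin.cons false σ)) (fun h => hc (funext fun σ => ?_))
        (fun σ => ?_) (fun m hm => ?_)
      · rw [← Fin.cons_self_tail σ]
        cases σ 0
        · exact congrFun h (Fin.tail σ)
        · exact h1' _
      · rw [hz, sum_fin_cons]
        simp [wordWeight, stepWeight, h1']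
      · have := h0 (m + 1) (by omega)
        rw [sum_fin_cons] at this
        simp only [Fintype.sum_bool, h1', zero_mul, Finset.sum_const_zero, zero_add,
          wallWord_succ_succ, Fin.prod_univ_succ, Fin.cons_zero, Fin.cons_succ] at this
        have h2 : (q : ℂ) * ∑ σ : Fin w → Bool, c (Fin.cons false σ) *
            ∏ k, overlap q (wallWord w m k) (σ k) = 0 := by
          rw [← this, Finset.mul_sum]
          exact Finset.sum_congr rfl fun σ _ => by simp [overlap]; ring
        exact (mul_eq_zero.1 h2).resolve_left hq0
    · refine norm_le_of_eigen_behind_wall hq h1 (fun σ => ?_) ?_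
      · rw [hz, sum_fin_cons, Finset.mul_sum]
        simp [wordWeight, stepWeight, mul_assoc]
      -- orthogonality to `q|1 1 … 1⟩ - |0 1 … 1⟩`, which kills the components with first site `0`
      · have ha := h0 0 (by omega)
        have hb := h0 1 (by omega)
        rw [sum_fin_cons] at ha hb
        simp only [Fintype.sum_bool, wallWord_succ_succ w 0, wallWord_zero, Fin.prod_univ_succ,
          Fin.cons_zero, Fin.cons_succ] at ha hb
        have htrue : ∀ k, wallWord w 0 k = true := fun k => by simp [wallWord]
        simp only [htrue, overlap, if_true, reduceCtorEq, if_false, one_mul] at ha hb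
        refine (mul_eq_zero.1 (?_ : ((q : ℂ) ^ 2 - 1) * _ = 0)).resolve_left hq1
        have e1 : ∀ (x : ℂ) (f g : (Fin w → Bool) → ℂ),
            ∑ σ, f σ * (x * g σ) = x * ∑ σ, f σ * g σ := fun x f g => by
          rw [Finset.mul_sum]
          exact Finset.sum_congr rfl fun σ _ => by ring
        rw [e1] at ha hb
        simp only [overlap]
        linear_combination (q : ℂ) * ha - hb

/-! ### Linear algebra: one Jordan block -/

section Jordan

variable {K E : Type*} [Field K] [AddCommGroup E] [Module K E]

lemma finrank_ker_pow_le [FiniteDimensional K E] (f : Module.End K E)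
    (hf : Module.finrank K (LinearMap.ker f) ≤ 1)
    (k : ℕ) : Module.finrank K (LinearMap.ker (f ^ k)) ≤ k := by
  induction k with
  | zero => simp [Module.End.one_eq_id]
  | succ k ih =>
    set g := f.domRestrict (LinearMap.ker (f ^ (k + 1))) with hg
    have h1 := g.finrank_range_add_finrank_ker
    have h2 : Module.finrank K (LinearMap.range g) ≤ k := by
      refine (Submodule.finrank_mono ?_).trans ih
      rintro _ ⟨⟨x, hx⟩, rfl⟩
      rw [LinearMap.mem_ker, pow_succ] at hx
      exact hx
    have h3 : Module.finrank K (LinearMap.ker g) ≤ 1 := by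
      rw [← Submodule.finrank_map_subtype_eq]
      refine (Submodule.finrank_mono ?_).trans hf
      rintro _ ⟨x, hx, rfl⟩
      exact hx
    omega

lemma linearIndependent_pow_apply {f : Module.End K E} {n : ℕ} {v : E} (h0 : (f ^ n) v = 0)
    (h1 : (f ^ (n - 1)) v ≠ 0) : LinearIndependent K fun i : Fin n => (f ^ i.val) v := by
  rw [Fintype.linearIndependent_iff]
  intro a ha
  have key : ∀ m (hm : m < n), a ⟨m, hm⟩ = 0 := by
    intro m
    induction m using Nat.strong_induction_on with
    | _ m ih =>
      intro hm
      have h2 := congrArg (f ^ (n - 1 - m)) ha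
      rw [map_sum, map_zero, Finset.sum_eq_single (⟨m, hm⟩ : Fin n)] at h2
      · rw [map_smul, ← Module.End.mul_apply, ← pow_add,
          show n - 1 - m + m = n - 1 by omega] at h2
        exact (smul_eq_zero.1 h2).resolve_right h1
      · intro i _ hi
        rcases lt_or_ge i.val m with h | h
        · rw [ih i.val h i.2, zero_smul, map_zero]
        · have hmi : m < i.val := lt_of_le_of_ne h fun h' => hi (Fin.ext h'.symm)
          rw [map_smul, ← Module.End.mul_apply, ← pow_add,
            show n - 1 - m + i.val = (n - 1 - m + i.val - n) + n by omega, pow_add,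
            Module.End.mul_apply, h0, map_zero, smul_zero]
      · simp
  exact fun i => key i.val i.2

/-- A nilpotent endomorphism whose kernel is at most a line is a single Jordan block: the powers
applied to a suitable vector form a basis. -/
lemma exists_basis_pow_of_isNilpotent [FiniteDimensional K E] {f : Module.End K E}
    (hf : IsNilpotent f)
    (hker : Module.finrank K (LinearMap.ker f) ≤ 1) {n : ℕ} (hn : 1 ≤ n)
    (hdim : Module.finrank K E = n) :
    ∃ (v : E) (b : Module.Basis (Fin n) K E), (f ^ n) v = 0 ∧
      ∀ i : Fin n, b i = (f ^ (n - 1 - i.val)) v := by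
  have hfn : f ^ n = 0 := by
    have h := f.aeval_self_charpoly
    rwa [hf.charpoly_eq_X_pow_finrank, hdim, map_pow, Polynomial.aeval_X] at h
  have hne : f ^ (n - 1) ≠ 0 := by
    intro h
    have h1 := finrank_ker_pow_le f hker (n - 1)
    rw [h, LinearMap.ker_zero, finrank_top, hdim] at h1
    omega
  obtain ⟨v, hv⟩ : ∃ v, (f ^ (n - 1)) v ≠ 0 := by
    by_contra! h
    exact hne (LinearMap.ext h)
  have h0 : (f ^ n) v = 0 := by rw [hfn]; rfl
  have hli := (linearIndependent_pow_apply h0 hv).comp Fin.rev Fin.rev_injective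
  have : Nonempty (Fin n) := ⟨⟨0, hn⟩⟩
  refine ⟨v, basisOfLinearIndependentOfCardEqFinrank hli (by rw [Fintype.card_fin, hdim]), h0,
    fun i => ?_⟩
  rw [coe_basisOfLinearIndependentOfCardEqFinrank, Function.comp_apply, Fin.val_rev,
    show n - (i.val + 1) = n - 1 - i.val by omega]

end Jordan

/-- If the eigenspace of `z` is at most a line, the operator is a single Jordan block on the
generalized eigenspace. -/
lemma exists_jordan_basis {E : Type*} [AddCommGroup E] [Module ℂ E] [FiniteDimensional ℂ E]
    (f : Module.End ℂ E) (z : ℂ) {n : ℕ} (hn : 1 ≤ n)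
    (hdim : Module.finrank ℂ (f.maxGenEigenspace z) = n)
    (hker : Module.finrank ℂ (f.eigenspace z) ≤ 1) :
    ∃ b : Module.Basis (Fin n) ℂ (f.maxGenEigenspace z),
      ∀ j, f (b j) = ∑ i, jordanBlock n z i j • (b i : E) := by
  have hmaps := Module.End.mapsTo_maxGenEigenspace_of_comm
    (Algebra.mul_sub_algebraMap_commutes f z) z
  set N := (f - algebraMap ℂ (Module.End ℂ E) z).restrict hmaps with hN
  have hnil : IsNilpotent N := f.isNilpotent_restrict_maxGenEigenspace_sub_algebraMap z hmaps
  have hval : ∀ x : f.maxGenEigenspace z, f x = z • (x : E) + N x := fun x => by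
    have h : (N x : E) = f x - z • (x : E) := rfl
    rw [h, add_sub_cancel]
  have hker' : Module.finrank ℂ (LinearMap.ker N) ≤ 1 := by
    rw [← Submodule.finrank_map_subtype_eq]
    refine (Submodule.finrank_mono ?_).trans hker
    rintro _ ⟨x, hx, rfl⟩
    have := hval x
    rw [LinearMap.mem_ker.1 hx] at this
    rw [Module.End.mem_eigenspace_iff]
    simpa using this
  obtain ⟨v, b, h0, hb⟩ := exists_basis_pow_of_isNilpotent hnil hker' hn hdim
  refine ⟨b, fun j => ?_⟩
  have hNb : ((N (b j) : f.maxGenEigenspace z) : E) =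
      ∑ i : Fin n, (if i.val + 1 = j.val then 1 else 0 : ℂ) • (b i : E) := by
    rw [hb, ← Module.End.mul_apply, ← pow_succ']
    rcases Nat.eq_zero_or_pos j.val with hj | hj
    · rw [hj, show n - 1 - 0 + 1 = n by omega, h0]
      simp
    · rw [Finset.sum_eq_single (⟨j.val - 1, by omega⟩ : Fin n)]
      · rw [if_pos (by simp; omega), one_smul, hb]
        congr 3
        simp
        omega
      · intro i _ hi
        rw [if_neg, zero_smul]
        intro h
        exact hi (Fin.ext (by simp; omega))
      · simp
  have hsplit : ∀ i, jordanBlock n z i j =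
      (if i = j then z else 0) + (if i.val + 1 = j.val then 1 else 0) := by
    intro i
    simp only [jordanBlock, Matrix.of_apply]
    split_ifs with h1 h2
    · subst h1; omega
    all_goals simp
  rw [hval, hNb]
  simp [hsplit, add_smul, Finset.sum_add_distrib]

/-! ### Linear algebra: triangular on an invariant subspace, small on its complement -/

section Triangular

variable {E : Type*} [NormedAddCommGroup E] [InnerProductSpace ℂ E]

lemma maxGenEigenspace_le_of_orthogonal [FiniteDimensional ℂ E] (f : Module.End ℂ E)
    (U : Submodule ℂ E)
    (hU : ∀ x ∈ U, f x ∈ U ∧ LinearMap.adjoint f x ∈ U) (z : ℂ)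
    (hz : ∀ x ∈ Uᗮ, f x = z • x → x = 0) : f.maxGenEigenspace z ≤ U := by
  intro x hx
  obtain ⟨k, hk⟩ := (Module.End.mem_maxGenEigenspace f z x).1 hx
  set g : Module.End ℂ E := f - z • 1 with hg
  have hg1 : ∀ y ∈ U, g y ∈ U := fun y hy => by
    simpa [hg] using U.sub_mem (hU y hy).1 (U.smul_mem z hy)
  -- invariance of `U` under the adjoint is invariance of `Uᗮ` under `f`
  have hg2 : ∀ y ∈ Uᗮ, g y ∈ Uᗮ := fun y hy => by
    have : f y ∈ Uᗮ := (Submodule.mem_orthogonal _ _).2 fun u hu => by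
      rw [← LinearMap.adjoint_inner_left]
      exact (Submodule.mem_orthogonal _ _).1 hy _ (hU u hu).2
    simpa [hg] using Uᗮ.sub_mem this (Uᗮ.smul_mem z hy)
  have hpow : ∀ (W : Submodule ℂ E), (∀ y ∈ W, g y ∈ W) → ∀ k, ∀ y ∈ W, (g ^ k) y ∈ W := by
    intro W hW k
    induction k with
    | zero => intro y hy; simpa using hy
    | succ k ih => intro y hy; rw [pow_succ]; exact ih _ (hW y hy)
  have hinj : ∀ k, ∀ y ∈ Uᗮ, (g ^ k) y = 0 → y = 0 := by
    intro k
    induction k with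
    | zero => intro y _ hy; simpa using hy
    | succ k ih =>
      intro y hy h
      rw [pow_succ] at h
      have h1 := ih (g y) (hg2 y hy) h
      exact hz y hy (by simpa [hg, sub_eq_zero] using h1)
  obtain ⟨u, hu, v, hv, rfl⟩ := U.exists_add_mem_mem_orthogonal x
  have h1 : (g ^ k) u = -(g ^ k) v := by rwa [map_add, add_eq_zero_iff_eq_neg] at hk
  have h2 : (g ^ k) v ∈ U := by
    rw [← neg_neg ((g ^ k) v), ← h1]
    exact U.neg_mem (hpow U hg1 k u hu)
  have h3 : (g ^ k) v = 0 := by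
    have := U.orthogonal_disjoint.le_bot ⟨h2, hpow Uᗮ hg2 k v hv⟩
    simpa using this
  rw [hinj k v hv h3, add_zero]
  exact hu

lemma rootMultiplicity_charpoly_restrict [FiniteDimensional ℂ E] (f : Module.End ℂ E)
    (U : Submodule ℂ E)
    (hU : ∀ x ∈ U, f x ∈ U) (z : ℂ) (hz : f.maxGenEigenspace z ≤ U) :
    f.charpoly.rootMultiplicity z = (LinearMap.restrict f hU).charpoly.rootMultiplicity z := by
  rw [← LinearMap.finrank_maxGenEigenspace_eq, ← LinearMap.finrank_maxGenEigenspace_eq,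
    ← (Submodule.comapSubtypeEquivOfLe hz).finrank_eq]
  exact congrArg (fun W : Submodule ℂ U => Module.finrank ℂ W)
    (f.genEigenspace_restrict U ⊤ z hU).symm

variable {w : ℕ} {e : Fin (w + 1) → E} {f : Module.End ℂ E} {z : ℂ}

lemma charpoly_restrict_of_triangular [FiniteDimensional ℂ E] (he : Orthonormal ℂ e)
    (hU : ∀ x ∈ Submodule.span ℂ (Set.range e), f x ∈ Submodule.span ℂ (Set.range e))
    (htri : ∀ m n, m < n → inner ℂ (e m) (f (e n)) = 0)
    (hdiag : ∀ m, inner ℂ (e m) (f (e m)) = if m.val = w then (1 : ℂ) else z) :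
    (LinearMap.restrict f hU).charpoly =
      (Polynomial.X - Polynomial.C z) ^ w * (Polynomial.X - Polynomial.C 1) := by
  set b := Module.Basis.span he.linearIndependent with hb
  have hrepr : ∀ (x : Submodule.span ℂ (Set.range e)) i, b.repr x i = inner ℂ (e i) (x : E) := by
    intro x i
    conv_rhs => rw [← b.sum_repr x]
    simp only [hb, Submodule.coe_sum, Submodule.coe_smul, Module.Basis.span_apply]
    rw [he.inner_right_fintype]
  have hM : ∀ i j, LinearMap.toMatrix b b (LinearMap.restrict f hU) i j =
      inner ℂ (e i) (f (e j)) := by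
    intro i j
    rw [LinearMap.toMatrix_apply, hrepr, LinearMap.coe_restrict_apply, hb,
      Module.Basis.span_apply]
  rw [← LinearMap.charpoly_toMatrix _ b, ← Matrix.charpoly_transpose,
    Matrix.charpoly_of_isUpperTriangular, Fin.prod_univ_castSucc]
  · simp [Matrix.transpose_apply, hM, hdiag, (Fin.is_lt _).ne]
  · intro i j hij
    rw [Matrix.transpose_apply, hM]
    exact htri _ _ hij

lemma finrank_eigenspace_le_one_of_triangular (hw : 1 ≤ w) (hz1 : z ≠ 1) (he : Orthonormal ℂ e)
    (hle : f.eigenspace z ≤ Submodule.span ℂ (Set.range e))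
    (htri : ∀ m n, m < n → inner ℂ (e m) (f (e n)) = 0)
    (hdiag : ∀ m, inner ℂ (e m) (f (e m)) = if m.val = w then (1 : ℂ) else z)
    (hsub : ∀ m n : Fin (w + 1), n.val = m.val + 1 → n.val < w →
      inner ℂ (e n) (f (e m)) ≠ (0 : ℂ)) :
    Module.finrank ℂ (f.eigenspace z) ≤ 1 := by
  set φ : f.eigenspace z →ₗ[ℂ] ℂ :=
    (innerₛₗ ℂ (e ⟨w - 1, by omega⟩)) ∘ₗ (f.eigenspace z).subtype with hφ
  suffices hinj : Function.Injective φ by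
    simpa using LinearMap.finrank_le_finrank_of_injective hinj
  rw [← LinearMap.ker_eq_bot, LinearMap.ker_eq_bot']
  rintro ⟨x, hx⟩ h0
  replace h0 : inner ℂ (e ⟨w - 1, by omega⟩) x = 0 := h0
  have hfx : f x = z • x := Module.End.mem_eigenspace_iff.1 hx
  obtain ⟨c, hc⟩ := (Submodule.mem_span_range_iff_exists_fun ℂ).1 (hle hx)
  have hcoef : ∀ m, inner ℂ (e m) x = c m := fun m => by rw [← hc, he.inner_right_fintype]
  -- the `m`-th row of the eigenvalue equation
  have hrow : ∀ m, z * c m = ∑ n, c n * inner ℂ (e m) (f (e n)) := by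
    intro m
    rw [← hcoef, ← inner_smul_right, ← hfx, ← hc, map_sum, inner_sum]
    exact Finset.sum_congr rfl fun n _ => by rw [map_smul, inner_smul_right]
  -- subdiagonal entries are nonzero, so row `k + 1` forces coordinate `k` to vanish
  have hzero : ∀ k (hk : k < w), c ⟨k, by omega⟩ = 0 := by
    intro k
    induction k using Nat.strong_induction_on with
    | _ k ih =>
      intro hk
      by_cases hlast : k = w - 1
      · subst hlast
        rw [← hcoef]
        exact h0
      · have hr := hrow ⟨k + 1, by omega⟩
        have hpair : (⟨k, by omega⟩ : Fin (w + 1)) ≠ ⟨k + 1, by omega⟩ := by simp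
        rw [Finset.sum_eq_add_of_mem _ _ (Finset.mem_univ _) (Finset.mem_univ _) hpair, hdiag,
          if_neg (by simp; omega), mul_comm z, right_eq_add] at hr
        · exact (mul_eq_zero.1 hr).resolve_right (hsub _ _ rfl (by simp; omega))
        · rintro n - ⟨h1, h2⟩
          rcases lt_or_ge n.val k with h | h
          · rw [ih n.val h (by omega), zero_mul]
          · rw [htri, mul_zero]
            rw [Fin.lt_def]
            have h1' : n.val ≠ k := fun h' => h1 (Fin.ext h')
            have h2' : n.val ≠ k + 1 := fun h' => h2 (Fin.ext h')
            simp
            omega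
  have hlast : c (Fin.last w) = 0 := by
    have hr := hrow (Fin.last w)
    rw [Fin.sum_univ_castSucc, Finset.sum_eq_zero, zero_add, hdiag,
      if_pos (by simp), mul_one] at hr
    · have : (z - 1) * c (Fin.last w) = 0 := by linear_combination hr
      exact (mul_eq_zero.1 this).resolve_left (sub_ne_zero.2 hz1)
    · intro i _
      rw [show i.castSucc = ⟨i.val, by omega⟩ from rfl, hzero _ i.2, zero_mul]
  refine Subtype.ext (hc.symm.trans ?_)
  refine Finset.sum_eq_zero fun m _ => ?_
  rcases Nat.lt_or_ge m.val w with h | h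
  · rw [show m = ⟨m.val, by omega⟩ from rfl, hzero _ h, zero_smul]
  · rw [show m = Fin.last w from Fin.ext (by simp; omega), hlast, zero_smul]

end Triangular

/-! ### Words of pairing states as vectors, and the action of the generator -/

/-- The vector `|τ₁ … τ_w⟩` of pairing states in the Hilbert space. -/
noncomputable def wordVec (q : ℕ) {w : ℕ} (τ : Fin w → Bool) : Space q w :=
  WithLp.toLp 2 (pairingWord q τ)

lemma domainWall_eq_wordVec (q w : ℕ) (m : Fin (w + 1)) :
    domainWall q w m = wordVec q (wallWord w m) := by
  have : (fun k : Fin w => if k.val < m.val then ket0 q else ket1 q) =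
      fun k => pairing q (wallWord w m k) := by
    ext k
    by_cases h : k.val < m.val
    · simp [h, wallWord, pairing, not_le.2 h]
    · simp [h, wallWord, pairing, not_lt.1 h]
  rw [domainWall, this]
  rfl

lemma T_apply {q w : ℕ} (x : Space q w) (i : Config q w) :
    T q w x i = ∑ j, chain q (ket0 q) (ket1 q) i j * x j := by
  simp only [← llgMatrix_apply]
  rfl

theorem T_wordVec {q w : ℕ} (hq : 2 ≤ q) (τ : Fin w → Bool) :
    T q w (wordVec q τ) =
      ∑ σ, wordWeight q (overlap q true) w false τ σ • wordVec q σ := by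
  ext i
  rw [T_apply]
  refine (sum_chain_mul_pairingWord hq true false τ i).trans ?_
  simp [wordVec]

lemma exists_T_eq_sum {q w : ℕ} (hq : 2 ≤ q) (x : Space q w) :
    ∃ c : (Fin w → Bool) → ℂ, T q w x = ∑ σ, c σ • wordVec q σ := by
  choose c hc using exists_chain_eq_sum (w := w) hq (ket1 q) (ket0 q)
  refine ⟨fun σ => ∑ j, c j σ * x j, ?_⟩
  ext i
  rw [T_apply]
  simp only [hc, wordVec, WithLp.ofLp_sum, WithLp.ofLp_smul, Finset.sum_apply, Pi.smul_apply,
    smul_eq_mul, Finset.sum_mul]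
  rw [Finset.sum_comm]
  exact Finset.sum_congr rfl fun _ _ => Finset.sum_congr rfl fun _ _ => by ring

lemma star_pairing {q : ℕ} (b : Bool) (s : Site q) : star (pairing q b s) = pairing q b s := by
  cases b <;> simp [pairing, ket0, ket1, apply_ite (starRingEnd ℂ)]

lemma star_pairingWord {q w : ℕ} (τ : Fin w → Bool) (i : Config q w) :
    star (pairingWord q τ i) = pairingWord q τ i := by
  simp only [pairingWord, star_prod, star_pairing]

lemma star_chain {q w : ℕ} (hq : 2 ≤ q) (a b : Bool) (i j : Config q w) :
    star (chain q (pairing q a) (pairing q b) i j) =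
      chain q (pairing q a) (pairing q b) i j := by
  have hw : ∀ s t, star (weingarten q s t) = weingarten q s t := fun s t => by
    simp only [weingarten]
    split_ifs <;> simp
  simp only [chain, avgGate_eq hq, star_sum, star_mul', star_prod, star_pairing, hw]

/-- The adjoint of the generator is a chain entered from the other end. -/
theorem adjoint_T_wordVec {q w : ℕ} (hq : 2 ≤ q) (τ : Fin w → Bool) :
    LinearMap.adjoint (T q w) (wordVec q τ) =
      ∑ σ, wordWeight q (overlap q false) w true (τ ∘ Fin.rev) σ • wordVec q (σ ∘ Fin.rev) := by
  have hrev : ∀ (σ : Fin w → Bool) (i : Config q w),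
      pairingWord q σ (i ∘ Fin.rev) = pairingWord q (σ ∘ Fin.rev) i := fun σ i => by
    simp only [pairingWord]
    rw [← Equiv.prod_comp Fin.revPerm]
    simp
  ext i
  rw [T, ← Matrix.toEuclideanLin_conjTranspose_eq_adjoint]
  have h : ∀ j, (llgMatrix q w).conjTranspose i j * pairingWord q τ j =
      chain q (pairing q true) (pairing q false) (i ∘ Fin.rev) (j ∘ Fin.rev) *
        pairingWord q (τ ∘ Fin.rev) (j ∘ Fin.rev) := by
    intro j
    rw [Matrix.conjTranspose_apply, llgMatrix_apply, ← hrev]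
    have := star_chain hq false true j i
    refine congrArg₂ _ (this.trans (chain_rev hq _ _ _ _)) ?_
    congr 1
    ext k
    simp
  calc _ = ∑ j, (llgMatrix q w).conjTranspose i j * pairingWord q τ j := rfl
    _ = ∑ j, chain q (pairing q true) (pairing q false) (i ∘ Fin.rev) j *
        pairingWord q (τ ∘ Fin.rev) j := by
      simp only [h]
      exact (Equiv.arrowCongr Fin.revPerm (Equiv.refl (Site q))).sum_comp (fun j =>
        chain q (pairing q true) (pairing q false) (i ∘ Fin.rev) j *
        pairingWord q (τ ∘ Fin.rev) j)
    _ = _ := by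
      rw [sum_chain_mul_pairingWord hq]
      simp [wordVec, hrev]

lemma sum_prod_config {q w : ℕ} (φ : Fin w → Site q → ℂ) :
    ∑ i : Config q w, ∏ k, φ k (i k) = ∏ k, ∑ s, φ k s := by
  rw [Finset.prod_univ_sum, Fintype.piFinset_univ]

lemma inner_wordVec {q w : ℕ} (hq : 2 ≤ q) (τ σ : Fin w → Bool) :
    inner ℂ (wordVec q τ) (wordVec q σ) = ∏ k, overlap q (τ k) (σ k) := by
  simp only [PiLp.inner_apply, RCLike.inner_apply, wordVec]
  calc _ = ∑ i : Config q w, ∏ k, pairing q (τ k) (i k) * pairing q (σ k) (i k) := by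
        refine Finset.sum_congr rfl fun i _ => ?_
        have := star_pairingWord τ i
        rw [← starRingEnd_apply] at this
        rw [this, pairingWord, pairingWord, ← Finset.prod_mul_distrib]
        exact Finset.prod_congr rfl fun _ _ => mul_comm _ _
    _ = _ := by
        rw [sum_prod_config fun k s => pairing q (τ k) s * pairing q (σ k) s]
        exact Finset.prod_congr rfl fun k _ => sum_pairing_mul_pairing hq _ _

/-- Words of pairing states are linearly independent: the products of the dual states
`q|s⟩ - |s̄⟩` separate them. -/
lemma linearIndependent_wordVec {q : ℕ} (hq : 2 ≤ q) (w : ℕ) :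
    LinearIndependent ℂ fun τ : Fin w → Bool => wordVec q τ := by
  have hq1 : (q : ℂ) ^ 2 - 1 ≠ 0 := by
    rw [sub_ne_zero]
    exact_mod_cast (Nat.one_lt_pow (by norm_num) (by omega : 1 < q)).ne'
  rw [Fintype.linearIndependent_iff]
  intro c hc τ
  have hdual : ∀ σ : Fin w → Bool, ∑ i : Config q w, (∏ k, (q * pairing q (τ k) (i k) -
      pairing q (!τ k) (i k))) * pairingWord q σ i =
        if τ = σ then ((q : ℂ) ^ 2 - 1) ^ w else 0 := by
    intro σ
    simp only [pairingWord, ← Finset.prod_mul_distrib]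
    rw [sum_prod_config fun k s => (q * pairing q (τ k) s - pairing q (!τ k) s) *
      pairing q (σ k) s]
    have hsite : ∀ a b : Bool, ∑ s, (q * pairing q a s - pairing q (!a) s) * pairing q b s =
        if a = b then (q : ℂ) ^ 2 - 1 else 0 := by
      intro a b
      simp only [sub_mul, mul_assoc, Finset.sum_sub_distrib, ← Finset.mul_sum,
        sum_pairing_mul_pairing hq]
      cases a <;> cases b <;> simp [overlap] <;> ring
    simp only [hsite]
    split_ifs with h
    · subst h; simp
    · obtain ⟨k, hk⟩ := Function.ne_iff.1 h
      exact Finset.prod_eq_zero (Finset.mem_univ k) (if_neg hk)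
  have h0 : ∑ σ, c σ * (if τ = σ then ((q : ℂ) ^ 2 - 1) ^ w else 0) = 0 := by
    simp only [← hdual, Finset.mul_sum]
    rw [Finset.sum_comm]
    refine Finset.sum_eq_zero fun i _ => ?_
    have := congrArg (fun x : Space q w => x i) hc
    simp only [wordVec, WithLp.ofLp_sum, WithLp.ofLp_smul, Finset.sum_apply, Pi.smul_apply,
      smul_eq_mul, WithLp.ofLp_zero, Pi.zero_apply] at this
    calc _ = (∏ k, (q * pairing q (τ k) (i k) - pairing q (!τ k) (i k))) *
          ∑ σ, c σ * pairingWord q σ i := by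
          rw [Finset.mul_sum]
          exact Finset.sum_congr rfl fun _ _ => by ring
      _ = 0 := by rw [this, mul_zero]
  simp only [mul_ite, mul_zero, Finset.sum_ite_eq, Finset.mem_univ, if_true] at h0
  exact (mul_eq_zero.1 h0).resolve_right (pow_ne_zero _ hq1)

/-- Eigenvectors orthogonal to `V_w` have eigenvalues of modulus at most `q³/(q²+1)²`. -/
theorem norm_le_of_mem_orthogonal_V {q w : ℕ} (hq : 2 ≤ q) {x : Space q w} (hx : x ∈ (V q w)ᗮ)
    (hx0 : x ≠ 0) {z : ℂ} (hz : T q w x = z • x) : ‖z‖ ≤ ‖kap q‖ ^ 2 * q := by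
  rcases eq_or_ne z 0 with rfl | hz0
  · simp only [norm_zero]; positivity
  obtain ⟨c, hc⟩ : ∃ c : (Fin w → Bool) → ℂ, x = ∑ σ, c σ • wordVec q σ := by
    obtain ⟨c, hc⟩ := exists_T_eq_sum hq x
    refine ⟨fun σ => z⁻¹ * c σ, ?_⟩
    simp only [mul_smul, ← Finset.smul_sum, ← hc, hz, inv_smul_smul₀ hz0]
  refine norm_le_of_eigen_orthogonal hq (c := c) ?_ (fun σ => ?_) (fun m hm => ?_)
  · rintro rfl
    exact hx0 (by simpa using hc)
  · rw [hc, map_sum, Finset.smul_sum] at hz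
    simp only [map_smul, T_wordVec hq, smul_smul, Finset.smul_sum] at hz
    rw [Finset.sum_comm, ← sub_eq_zero, ← Finset.sum_sub_distrib] at hz
    simp only [← Finset.sum_smul, ← sub_smul] at hz
    have := Fintype.linearIndependent_iff.1 (linearIndependent_wordVec hq w) _ hz σ
    rw [sub_eq_zero] at this
    rw [← this]
    exact Finset.sum_congr rfl fun _ _ => mul_comm _ _
  · have h := (Submodule.mem_orthogonal _ _).1 hx (wordVec q (wallWord w m))
      (Submodule.subset_span ⟨⟨m, by omega⟩, domainWall_eq_wordVec q w _⟩)
    rw [hc, inner_sum] at h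
    simpa only [inner_smul_right, inner_wordVec hq] using h

/-! ### The generator on domain walls -/

/-- The word `b^m b̄^{w-m}` with at most one domain wall. -/
def orientedWall (b : Bool) (w m : ℕ) (k : Fin w) : Bool := xor b (decide (m ≤ k))

lemma orientedWall_false (w m : ℕ) : orientedWall false w m = wallWord w m := by
  ext k
  simp [orientedWall, wallWord]

lemma orientedWall_succ_succ (b : Bool) (w m : ℕ) :
    orientedWall b (w + 1) (m + 1) = Fin.cons b (orientedWall b w m) := by
  ext k
  refine Fin.cases ?_ (fun k => ?_) k <;> simp [orientedWall]

lemma orientedWall_zero (b : Bool) (w : ℕ) :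
    orientedWall b (w + 1) 0 = Fin.cons (!b) (orientedWall b w 0) := by
  ext k
  refine Fin.cases ?_ (fun k => ?_) k <;> simp [orientedWall]

lemma orientedWall_not (b : Bool) (w : ℕ) :
    orientedWall (!b) w w = orientedWall b w 0 := by
  ext k
  simp [orientedWall, not_le.2 k.2]

lemma wallWord_comp_rev {w m : ℕ} (hm : m ≤ w) :
    wallWord w m ∘ Fin.rev = orientedWall true w (w - m) := by
  ext k
  simp only [Function.comp_apply, wallWord, orientedWall, Fin.val_rev, Bool.true_xor,
    ← decide_not, decide_eq_decide]
  omega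

lemma orientedWall_true_comp_rev {w m : ℕ} (hm : m ≤ w) :
    orientedWall true w m ∘ Fin.rev = wallWord w (w - m) := by
  ext k
  have := congrFun (wallWord_comp_rev (Nat.sub_le w m)) k.rev
  rw [Nat.sub_sub_self hm] at this
  simpa using this.symm

/-- The chain entered in the state `b` moves a domain wall `b|b̄` only away from its entrance. -/
lemma eq_orientedWall_of_wordWeight_ne_zero {q : ℕ} {g : Bool → ℂ} : ∀ {w : ℕ} {b : Bool} {l : ℕ}
    {σ : Fin w → Bool}, l ≤ w → wordWeight q g w b (orientedWall b w l) σ ≠ 0 →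
    ∃ l', l ≤ l' ∧ l' ≤ w ∧ σ = orientedWall b w l' := by
  intro w
  induction w with
  | zero =>
    intro b l σ hl _
    exact ⟨0, hl, le_rfl, Subsingleton.elim _ _⟩
  | succ w ih =>
    intro b l σ hl h
    obtain ⟨s, ρ, rfl⟩ : ∃ s ρ, σ = Fin.cons s ρ := ⟨σ 0, Fin.tail σ, (Fin.cons_self_tail σ).symm⟩
    cases l with
    | zero =>
      rw [orientedWall_zero, wordWeight] at h
      simp only [Fin.cons_zero, Fin.tail_cons] at h
      have h2 := right_ne_zero_of_mul h
      by_cases hs : s = b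
      · subst hs
        obtain ⟨l', -, hl', rfl⟩ := ih (Nat.zero_le w) h2
        exact ⟨l' + 1, by omega, by omega, (orientedWall_succ_succ _ _ _).symm⟩
      · obtain rfl : s = !b := by cases s <;> cases b <;> simp_all
        rw [← orientedWall_not] at h2
        obtain ⟨l', h3, h4, rfl⟩ := ih le_rfl h2
        obtain rfl : l' = w := le_antisymm h4 h3
        exact ⟨0, le_rfl, by omega, by rw [orientedWall_zero, orientedWall_not]⟩
    | succ l =>
      rw [orientedWall_succ_succ, wordWeight] at h
      simp only [Fin.cons_zero, Fin.tail_cons] at h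
      have h1 := left_ne_zero_of_mul h
      have h2 := right_ne_zero_of_mul h
      obtain rfl : s = b := by
        by_contra hs
        simp [stepWeight, hs] at h1
      obtain ⟨l', h3, h4, rfl⟩ := ih (by omega) h2
      exact ⟨l' + 1, by omega, by omega, (orientedWall_succ_succ _ _ _).symm⟩

lemma wallWord_injective {w m m' : ℕ} (hm : m ≤ w) (hm' : m' ≤ w)
    (h : wallWord w m = wallWord w m') : m = m' := by
  by_contra hne
  rcases lt_or_gt_of_ne hne with hlt | hlt
  · have := congrFun h ⟨m, by omega⟩
    simp [wallWord] at this
    omega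
  · have := congrFun h ⟨m', by omega⟩
    simp [wallWord] at this
    omega

/-- The matrix entry of the generator between domain walls. -/
noncomputable def wallWeight (q w l l' : ℕ) : ℂ :=
  wordWeight q (overlap q true) w false (wallWord w l) (wallWord w l')

lemma wallWeight_eq_zero {q w l l' : ℕ} (hl : l ≤ w) (hlt : l' < l) : wallWeight q w l l' = 0 := by
  by_contra h
  rw [wallWeight, ← orientedWall_false w l] at h
  obtain ⟨k, h1, h2, h3⟩ := eq_orientedWall_of_wordWeight_ne_zero hl h
  rw [orientedWall_false] at h3
  have := wallWord_injective (by omega) h2 h3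
  omega

lemma wallWeight_succ_succ (q w l l' : ℕ) :
    wallWeight q (w + 1) (l + 1) (l' + 1) = wallWeight q w l l' := by
  simp [wallWeight, wallWord_succ_succ, wordWeight, stepWeight]

lemma wordWeight_true_wallWord_zero (q w : ℕ) :
    wordWeight q (overlap q true) w true (wallWord w 0) (wallWord w 0) = q := by
  induction w with
  | zero => simp [wordWeight, overlap]
  | succ w ih => simp [wallWord_zero, wordWeight, stepWeight, ih]

lemma wallWeight_zero_zero (q w : ℕ) : wallWeight q (w + 1) 0 0 = kap q * q := by
  simp [wallWeight, wallWord_zero, wordWeight, stepWeight, wordWeight_true_wallWord_zero]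

lemma wallWeight_zero_one (q w : ℕ) : wallWeight q (w + 2) 0 1 = kap q ^ 2 * q := by
  have : wallWeight q (w + 2) 0 1 = kap q * wallWeight q (w + 1) 0 0 := by
    simp only [wallWeight, wordWeight]
    rw [wallWord_zero (w + 1), wallWord_succ_succ (w + 1) 0]
    simp [stepWeight]
  rw [this, wallWeight_zero_zero]
  ring

lemma wallWeight_self {q w l : ℕ} (hl : l < w) : wallWeight q w l l = kap q * q := by
  obtain ⟨k, rfl⟩ := Nat.exists_eq_add_of_lt hl
  induction l with
  | zero => rw [show 0 + k + 1 = k + 1 by omega, wallWeight_zero_zero]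
  | succ l ih =>
    rw [show l + 1 + k + 1 = (l + k + 1) + 1 by omega, wallWeight_succ_succ]
    exact ih (by omega)

lemma wallWeight_last (q w : ℕ) : wallWeight q w w w = 1 := by
  induction w with
  | zero => simp [wallWeight, wordWeight, overlap]
  | succ w ih => rw [wallWeight_succ_succ, ih]

lemma wallWeight_self_succ {q w l : ℕ} (hl : l + 1 < w) :
    wallWeight q w l (l + 1) = kap q ^ 2 * q := by
  obtain ⟨k, rfl⟩ := Nat.exists_eq_add_of_lt hl
  induction l with
  | zero => rw [show 0 + 1 + k + 1 = k + 2 by omega, wallWeight_zero_one]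
  | succ l ih =>
    rw [show l + 1 + 1 + k + 1 = (l + 1 + k + 1) + 1 by omega, wallWeight_succ_succ]
    exact ih (by omega)

theorem T_wallWord {q w l : ℕ} (hq : 2 ≤ q) (hl : l ≤ w) :
    T q w (wordVec q (wallWord w l)) =
      ∑ l' : Fin (w + 1), wallWeight q w l l' • wordVec q (wallWord w l') := by
  rw [T_wordVec hq]
  refine (Fintype.sum_of_injective (fun l' : Fin (w + 1) => wallWord w l') ?_ _ _ ?_ ?_).symm
  · intro a b hab
    exact Fin.ext (wallWord_injective (by omega) (by omega) hab)
  · intro σ hσ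
    by_cases h : wordWeight q (overlap q true) w false (wallWord w l) σ = 0
    · rw [h, zero_smul]
    · rw [← orientedWall_false w l] at h
      obtain ⟨l', -, h2, rfl⟩ := eq_orientedWall_of_wordWeight_ne_zero hl h
      exact absurd ⟨⟨l', by omega⟩, (orientedWall_false w l').symm⟩ hσ
  · intro l'
    rfl

lemma wordVec_wallWord_mem_V {q w l : ℕ} (hl : l ≤ w) : wordVec q (wallWord w l) ∈ V q w :=
  Submodule.subset_span ⟨⟨l, by omega⟩, domainWall_eq_wordVec q w _⟩

theorem T_mem_V {q w : ℕ} (hq : 2 ≤ q) {x : Space q w} (hx : x ∈ V q w) : T q w x ∈ V q w := by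
  suffices h : V q w ≤ (V q w).comap (T q w) from h hx
  rw [V, Submodule.span_le]
  rintro _ ⟨m, rfl⟩
  rw [SetLike.mem_coe, Submodule.mem_comap, domainWall_eq_wordVec, T_wallWord hq (by omega)]
  exact Submodule.sum_mem _ fun l _ => Submodule.smul_mem _ _ (wordVec_wallWord_mem_V (by omega))

theorem adjoint_T_mem_V {q w : ℕ} (hq : 2 ≤ q) {x : Space q w} (hx : x ∈ V q w) :
    LinearMap.adjoint (T q w) x ∈ V q w := by
  suffices h : V q w ≤ (V q w).comap (LinearMap.adjoint (T q w)) from h hx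
  rw [V, Submodule.span_le]
  rintro _ ⟨m, rfl⟩
  rw [SetLike.mem_coe, Submodule.mem_comap, domainWall_eq_wordVec, adjoint_T_wordVec hq,
    wallWord_comp_rev (by omega)]
  refine Submodule.sum_mem _ fun σ _ => ?_
  by_cases h : wordWeight q (overlap q false) w true (orientedWall true w (w - m)) σ = 0
  · rw [h, zero_smul]
    exact Submodule.zero_mem _
  · obtain ⟨l, -, h2, rfl⟩ := eq_orientedWall_of_wordWeight_ne_zero (by omega) h
    rw [orientedWall_true_comp_rev h2]
    exact Submodule.smul_mem _ _ (wordVec_wallWord_mem_V (by omega))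

lemma overlap_self (q : ℕ) (b : Bool) : overlap q b b = q := if_pos rfl

lemma overlap_true_false (q : ℕ) : overlap q true false = 1 := if_neg (by simp)

lemma overlap_comm (q : ℕ) (a b : Bool) : overlap q a b = overlap q b a := by
  simp only [overlap, eq_comm]

lemma inner_wallWord {q : ℕ} (hq : 2 ≤ q) {w m m' : ℕ} (h : m ≤ m') (hm' : m' ≤ w) :
    inner ℂ (wordVec q (wallWord w m)) (wordVec q (wallWord w m')) =
      (q : ℂ) ^ (w - (m' - m)) := by
  rw [inner_wordVec hq]
  induction w generalizing m m' with
  | zero => simp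
  | succ w ih =>
    rw [Fin.prod_univ_succ]
    rcases m with _ | m <;> rcases m' with _ | m'
    · simp only [wallWord_zero, Fin.cons_zero, Fin.cons_succ, overlap_self, Finset.prod_const,
        Finset.card_univ, Fintype.card_fin, Nat.sub_zero, pow_succ']
    · simp only [wallWord_zero, wallWord_succ_succ, Fin.cons_zero, Fin.cons_succ,
        overlap_true_false, one_mul, ih (Nat.zero_le m') (by omega : m' ≤ w)]
      congr 1
      omega
    · omega
    · simp only [wallWord_succ_succ, Fin.cons_zero, Fin.cons_succ, overlap_self,
        ih (by omega : m ≤ m') (by omega : m' ≤ w)]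
      rw [← pow_succ']
      congr 1
      omega

lemma inner_wallWord_symm {q : ℕ} (hq : 2 ≤ q) {w : ℕ} (m m' : ℕ) :
    inner ℂ (wordVec q (wallWord w m)) (wordVec q (wallWord w m')) =
      (inner ℂ (wordVec q (wallWord w m')) (wordVec q (wallWord w m)) : ℂ) := by
  simp only [inner_wordVec hq]
  exact Finset.prod_congr rfl fun _ _ => overlap_comm _ _ _

/-! ### The orthonormal basis -/

/-- The unnormalized basis vectors `q|0^m 1^{w-m}⟩ - |0^{m+1} 1^{w-m-1}⟩` for `m < w`, and
`|0^w⟩`. -/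
noncomputable def wallDiff (q w m : ℕ) : Space q w :=
  if m = w then wordVec q (wallWord w w)
  else (q : ℂ) • wordVec q (wallWord w m) - wordVec q (wallWord w (m + 1))

lemma wallDiff_of_lt {q w m : ℕ} (h : m < w) : wallDiff q w m =
    (q : ℂ) • wordVec q (wallWord w m) - wordVec q (wallWord w (m + 1)) := if_neg h.ne

lemma wallDiff_last (q w : ℕ) : wallDiff q w w = wordVec q (wallWord w w) := if_pos rfl

/-- The normalization of the basis vectors. -/
noncomputable def basisNorm (q w m : ℕ) : ℂ :=
  if m = w then ((1 / √(q : ℝ) ^ w : ℝ) : ℂ)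
  else ((1 / (√(q : ℝ) ^ w * √((q : ℝ) ^ 2 - 1)) : ℝ) : ℂ)

lemma productVector_wall {q w m : ℕ} (h : m < w) :
    (productVector fun k : Fin w => if k.val < m then ket0 q
      else if k.val = m then fun s => (q : ℂ) * ket1 q s - ket0 q s else ket1 q) =
      (q : ℂ) • wordVec q (wallWord w m) - wordVec q (wallWord w (m + 1)) := by
  ext i
  simp only [productVector, wordVec, pairingWord, WithLp.ofLp_sub, WithLp.ofLp_smul,
    Pi.sub_apply, Pi.smul_apply, smul_eq_mul]
  rw [Fintype.prod_eq_mul_prod_compl ⟨m, h⟩, Fintype.prod_eq_mul_prod_compl ⟨m, h⟩,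
    Fintype.prod_eq_mul_prod_compl ⟨m, h⟩]
  have h1 : ∀ k ∈ ({⟨m, h⟩}ᶜ : Finset (Fin w)), (if k.val < m then ket0 q
      else if k.val = m then fun s => (q : ℂ) * ket1 q s - ket0 q s else ket1 q) (i k) =
      pairing q (wallWord w m k) (i k) := by
    intro k hk
    have hne : k.val ≠ m := fun hk' => by simp [← hk'] at hk
    rw [if_neg hne]
    by_cases hlt : k.val < m
    · simp [hlt, wallWord, pairing, not_le.2 hlt]
    · simp [hlt, wallWord, pairing, not_lt.1 hlt]
  have h2 : ∀ k ∈ ({⟨m, h⟩}ᶜ : Finset (Fin w)), pairing q (wallWord w (m + 1) k) (i k) =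
      pairing q (wallWord w m k) (i k) := by
    intro k hk
    have hne : k.val ≠ m := fun hk' => by simp [← hk'] at hk
    congr 1
    simp only [wallWord, decide_eq_decide]
    omega
  rw [Finset.prod_congr rfl h1, Finset.prod_congr rfl h2]
  simp [wallWord, pairing]
  ring

lemma e_eq (q w : ℕ) (m : Fin (w + 1)) : e q w m = basisNorm q w m • wallDiff q w m := by
  rw [e, basisNorm]
  congr 1
  rcases Nat.lt_or_ge m.val w with h | h
  · rw [wallDiff_of_lt h, productVector_wall h]
  · have hm : m.val = w := by omega
    rw [hm, wallDiff_last, wordVec, productVector]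
    congr 1
    ext i
    refine Finset.prod_congr rfl fun k _ => ?_
    simp [wallWord, pairing, k.2, not_le.2 k.2]

lemma inner_wallDiff_of_lt {q w m k : ℕ} (hq : 2 ≤ q) (h : m < k) (hk : k ≤ w) :
    inner ℂ (wallDiff q w m) (wordVec q (wallWord w k)) = (0 : ℂ) := by
  rw [wallDiff_of_lt (by omega), inner_sub_left, inner_smul_left, inner_wallWord hq h.le hk,
    inner_wallWord hq (show m + 1 ≤ k from h) hk, Complex.conj_natCast, ← pow_succ', sub_eq_zero]
  congr 1
  omega

lemma inner_wallDiff_self_wall {q w m : ℕ} (hq : 2 ≤ q) (h : m < w) :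
    inner ℂ (wallDiff q w m) (wordVec q (wallWord w m)) =
      (q : ℂ) ^ (w - 1) * ((q : ℂ) ^ 2 - 1) := by
  obtain ⟨v, rfl⟩ : ∃ v, w = v + 1 := ⟨w - 1, by omega⟩
  rw [wallDiff_of_lt h, inner_sub_left, inner_smul_left, inner_wallWord hq le_rfl h.le,
    inner_wallWord_symm hq, inner_wallWord hq (Nat.le_succ m) h, Complex.conj_natCast]
  simp
  ring

lemma inner_wallDiff_wallDiff_of_lt {q w m n : ℕ} (hq : 2 ≤ q) (h : m < n) (hn : n ≤ w) :
    inner ℂ (wallDiff q w m) (wallDiff q w n) = (0 : ℂ) := by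
  rcases hn.lt_or_eq with hlt | rfl
  · rw [wallDiff_of_lt hlt, inner_sub_right, inner_smul_right, inner_wallDiff_of_lt hq h hn,
      inner_wallDiff_of_lt hq (by omega) hlt, mul_zero, sub_zero]
  · rw [wallDiff_last, inner_wallDiff_of_lt hq h le_rfl]

lemma inner_wallDiff_self {q w m : ℕ} (hq : 2 ≤ q) (h : m < w) :
    inner ℂ (wallDiff q w m) (wallDiff q w m) =
      (q : ℂ) * ((q : ℂ) ^ (w - 1) * ((q : ℂ) ^ 2 - 1)) := by
  nth_rewrite 2 [wallDiff_of_lt h]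
  rw [inner_sub_right, inner_smul_right, inner_wallDiff_self_wall hq h,
    inner_wallDiff_of_lt hq (Nat.lt_succ_self m) h, sub_zero]

lemma inner_wallDiff_last {q w : ℕ} (hq : 2 ≤ q) :
    inner ℂ (wallDiff q w w) (wallDiff q w w) = (q : ℂ) ^ w := by
  rw [wallDiff_last, inner_wallWord hq le_rfl le_rfl]
  simp

lemma conj_basisNorm (q w m : ℕ) : (starRingEnd ℂ) (basisNorm q w m) = basisNorm q w m := by
  simp only [basisNorm]
  split_ifs <;> exact Complex.conj_ofReal _

lemma basisNorm_mul_self_mul {q w m : ℕ} (hq : 2 ≤ q) (h : m < w) :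
    basisNorm q w m * basisNorm q w m * ((q : ℂ) * ((q : ℂ) ^ (w - 1) * ((q : ℂ) ^ 2 - 1))) =
      1 := by
  have hq0 : (0 : ℝ) < q := by exact_mod_cast (by omega : 0 < q)
  have hq1 : (0 : ℝ) < (q : ℝ) ^ 2 - 1 := by
    rw [sub_pos]
    exact_mod_cast Nat.one_lt_pow (by norm_num) (by omega : 1 < q)
  have hw : (q : ℂ) * ((q : ℂ) ^ (w - 1) * ((q : ℂ) ^ 2 - 1)) =
      (((q : ℝ) ^ w * ((q : ℝ) ^ 2 - 1) : ℝ) : ℂ) := by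
    rw [← mul_assoc, ← pow_succ', Nat.sub_add_cancel (by omega)]
    push_cast
    rfl
  rw [hw, basisNorm, if_neg h.ne, ← Complex.ofReal_mul, ← Complex.ofReal_mul, ← Complex.ofReal_one]
  congr 1
  have h1 : √(q : ℝ) ^ w * √(q : ℝ) ^ w = (q : ℝ) ^ w := by
    rw [← mul_pow, Real.mul_self_sqrt hq0.le]
  have h2 := Real.mul_self_sqrt hq1.le
  have h3 : (q : ℝ) ^ w ≠ 0 := by positivity
  rw [div_mul_div_comm, mul_mul_mul_comm, h1, h2, one_mul, one_div_mul_cancel]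
  exact mul_ne_zero h3 hq1.ne'

lemma basisNorm_last_mul_self_mul {q w : ℕ} (hq : 2 ≤ q) :
    basisNorm q w w * basisNorm q w w * (q : ℂ) ^ w = 1 := by
  have hq0 : (0 : ℝ) < q := by exact_mod_cast (by omega : 0 < q)
  have hw : (q : ℂ) ^ w = (((q : ℝ) ^ w : ℝ) : ℂ) := by push_cast; rfl
  rw [hw, basisNorm, if_pos rfl, ← Complex.ofReal_mul, ← Complex.ofReal_mul, ← Complex.ofReal_one]
  congr 1
  rw [div_mul_div_comm, ← mul_pow, Real.mul_self_sqrt hq0.le, one_mul, one_div_mul_cancel]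
  positivity

theorem orthonormal_e {q : ℕ} (hq : 2 ≤ q) (w : ℕ) : Orthonormal ℂ (e q w) := by
  have hlt : ∀ m n : Fin (w + 1), m < n → inner ℂ (e q w m) (e q w n) = (0 : ℂ) := by
    intro m n h
    rw [e_eq, e_eq, inner_smul_left, inner_smul_right,
      inner_wallDiff_wallDiff_of_lt hq h (by omega), mul_zero, mul_zero]
  rw [orthonormal_iff_ite]
  intro m n
  rcases lt_trichotomy m n with h | rfl | h
  · rw [hlt m n h, if_neg h.ne]
  · rw [if_pos rfl, e_eq, inner_smul_left, inner_smul_right, conj_basisNorm, ← mul_assoc]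
    rcases Nat.lt_or_ge m.val w with hm | hm
    · rw [inner_wallDiff_self hq hm, basisNorm_mul_self_mul hq hm]
    · rw [show m.val = w by omega, inner_wallDiff_last hq, basisNorm_last_mul_self_mul hq]
  · rw [← inner_conj_symm, hlt n m h, map_zero, if_neg h.ne']

theorem span_e {q : ℕ} (hq : 2 ≤ q) (w : ℕ) :
    Submodule.span ℂ (Set.range (e q w)) = V q w := by
  apply Submodule.eq_of_le_of_finrank_le
  · rw [Submodule.span_le]
    rintro _ ⟨m, rfl⟩
    rw [SetLike.mem_coe, e_eq]
    refine Submodule.smul_mem _ _ ?_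
    rcases Nat.lt_or_ge m.val w with hm | hm
    · rw [wallDiff_of_lt hm]
      exact Submodule.sub_mem _ (Submodule.smul_mem _ _ (wordVec_wallWord_mem_V hm.le))
        (wordVec_wallWord_mem_V hm)
    · rw [show m.val = w by omega, wallDiff_last]
      exact wordVec_wallWord_mem_V le_rfl
  · rw [finrank_span_eq_card (orthonormal_e hq w).linearIndependent]
    exact finrank_range_le_card _

lemma inner_wallDiff_T_wall {q w l : ℕ} (hq : 2 ≤ q) (m : ℕ) (hl : l ≤ w) :
    inner ℂ (wallDiff q w m) (T q w (wordVec q (wallWord w l))) =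
      ∑ l' : Fin (w + 1), wallWeight q w l l' *
        (inner ℂ (wallDiff q w m) (wordVec q (wallWord w l')) : ℂ) := by
  rw [T_wallWord hq hl, inner_sum]
  exact Finset.sum_congr rfl fun _ _ => inner_smul_right _ _ _

lemma inner_wallDiff_T_wall_of_lt {q w m l : ℕ} (hq : 2 ≤ q) (h : m < l) (hl : l ≤ w) :
    inner ℂ (wallDiff q w m) (T q w (wordVec q (wallWord w l))) = (0 : ℂ) := by
  rw [inner_wallDiff_T_wall hq m hl]
  refine Finset.sum_eq_zero fun l' _ => ?_
  rcases Nat.lt_or_ge l'.val l with h' | h'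
  · rw [wallWeight_eq_zero hl h', zero_mul]
  · rw [inner_wallDiff_of_lt hq (by omega) (by omega), mul_zero]

lemma inner_wallDiff_T_wall_self {q w l : ℕ} (hq : 2 ≤ q) (hl : l ≤ w) :
    inner ℂ (wallDiff q w l) (T q w (wordVec q (wallWord w l))) =
      wallWeight q w l l * inner ℂ (wallDiff q w l) (wordVec q (wallWord w l)) := by
  rw [inner_wallDiff_T_wall hq l hl, Finset.sum_eq_single ⟨l, by omega⟩]
  · intro l' _ hne
    rcases lt_or_gt_of_ne (Fin.val_ne_of_ne hne) with h' | h'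
    · rw [wallWeight_eq_zero hl h', zero_mul]
    · rw [inner_wallDiff_of_lt hq h' (by omega), mul_zero]
  · simp

lemma inner_wallDiff_T_wall_succ {q w l : ℕ} (hq : 2 ≤ q) (hl : l + 1 ≤ w) :
    inner ℂ (wallDiff q w (l + 1)) (T q w (wordVec q (wallWord w l))) =
      wallWeight q w l l * inner ℂ (wallDiff q w (l + 1)) (wordVec q (wallWord w l)) +
      wallWeight q w l (l + 1) *
        inner ℂ (wallDiff q w (l + 1)) (wordVec q (wallWord w (l + 1))) := by
  rw [inner_wallDiff_T_wall hq (l + 1) (by omega), Finset.sum_eq_add_of_mem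
    (⟨l, by omega⟩ : Fin (w + 1)) ⟨l + 1, by omega⟩ (Finset.mem_univ _) (Finset.mem_univ _)
    (by simp)]
  rintro l' - ⟨h1, h2⟩
  have h1' := Fin.val_ne_of_ne h1
  have h2' := Fin.val_ne_of_ne h2
  simp only at h1' h2'
  rcases Nat.lt_or_ge l'.val l with h' | h'
  · rw [wallWeight_eq_zero (by omega) h', zero_mul]
  · rw [inner_wallDiff_of_lt hq (by omega) (by omega), mul_zero]

lemma inner_e_T_e {q w : ℕ} (m n : Fin (w + 1)) :
    inner ℂ (e q w m) (T q w (e q w n)) = basisNorm q w m * basisNorm q w n *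
      (inner ℂ (wallDiff q w m) (T q w (wallDiff q w n)) : ℂ) := by
  rw [e_eq, e_eq, map_smul, inner_smul_left, inner_smul_right, conj_basisNorm]
  ring

theorem inner_e_T_e_of_lt {q w : ℕ} (hq : 2 ≤ q) {m n : Fin (w + 1)} (h : m < n) :
    inner ℂ (e q w m) (T q w (e q w n)) = (0 : ℂ) := by
  rw [inner_e_T_e]
  rcases Nat.lt_or_ge n.val w with hn | hn
  · rw [wallDiff_of_lt hn, map_sub, map_smul, inner_sub_right, inner_smul_right,
      inner_wallDiff_T_wall_of_lt hq h hn.le,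
      inner_wallDiff_T_wall_of_lt hq (Nat.lt_succ_of_lt h) hn]
    simp
  · have hn' : n.val = w := by omega
    rw [hn', wallDiff_last, inner_wallDiff_T_wall_of_lt hq (by omega) le_rfl, mul_zero]

theorem inner_e_T_e_self {q w : ℕ} (hq : 2 ≤ q) (m : Fin (w + 1)) :
    inner ℂ (e q w m) (T q w (e q w m)) = if m.val = w then (1 : ℂ) else kap q * q := by
  rw [inner_e_T_e]
  rcases Nat.lt_or_ge m.val w with hm | hm
  · have h : (inner ℂ (wallDiff q w m) (T q w (wallDiff q w m)) : ℂ) =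
        kap q * q * (q * ((q : ℂ) ^ (w - 1) * ((q : ℂ) ^ 2 - 1))) := by
      nth_rewrite 2 [wallDiff_of_lt hm]
      rw [map_sub, map_smul, inner_sub_right, inner_smul_right,
        inner_wallDiff_T_wall_self hq hm.le,
        inner_wallDiff_T_wall_of_lt hq (Nat.lt_succ_self _) hm, wallWeight_self hm,
        inner_wallDiff_self_wall hq hm]
      ring
    rw [if_neg hm.ne, h]
    linear_combination kap q * q * basisNorm_mul_self_mul hq hm
  · have hm' : m.val = w := by omega
    have h := inner_wallDiff_T_wall_self hq (le_refl w)
    rw [← wallDiff_last, inner_wallDiff_last hq, wallWeight_last, one_mul] at h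
    rw [if_pos hm', hm', h, basisNorm_last_mul_self_mul hq]

theorem inner_e_T_e_succ {q w : ℕ} (hq : 2 ≤ q) {m n : Fin (w + 1)} (hmn : n.val = m.val + 1)
    (hn : n.val < w) :
    inner ℂ (e q w n) (T q w (e q w m)) = (q : ℂ) ^ 3 / ((q : ℂ) ^ 2 + 1) ^ 2 := by
  have hm : m.val < w := by omega
  have hnorm : basisNorm q w m = basisNorm q w n := by
    rw [basisNorm, basisNorm, if_neg hm.ne, if_neg hn.ne]
  -- `q|0^m 1^{w-m}⟩` is the sum of the basis vector `m`, orthogonal to the basis vector `m+1`,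
  -- and the next domain wall
  have hJ : (q : ℂ) * inner ℂ (wallDiff q w (m + 1)) (wordVec q (wallWord w m)) =
      inner ℂ (wallDiff q w (m + 1)) (wordVec q (wallWord w (m + 1))) := by
    have h := inner_wallDiff_wallDiff_of_lt (w := w) hq (Nat.lt_succ_self m.val) (by omega)
    rw [← inner_conj_symm, map_eq_zero, wallDiff_of_lt hm, inner_sub_right, inner_smul_right,
      sub_eq_zero] at h
    exact h
  have h : (inner ℂ (wallDiff q w n) (T q w (wallDiff q w m)) : ℂ) =
      kap q ^ 2 * q * (q * ((q : ℂ) ^ (w - 1) * ((q : ℂ) ^ 2 - 1))) := by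
    rw [hmn] at hn ⊢
    rw [wallDiff_of_lt hm, map_sub, map_smul, inner_sub_right, inner_smul_right,
      inner_wallDiff_T_wall_self hq (by omega : m.val + 1 ≤ w), wallWeight_self hn,
      inner_wallDiff_T_wall_succ hq (by omega), wallWeight_self hm, wallWeight_self_succ hn]
    rw [inner_wallDiff_self_wall hq hn] at hJ ⊢
    linear_combination (kap q * q) * hJ
  rw [inner_e_T_e, hnorm, h]
  have hk : kap q ^ 2 * q = (q : ℂ) ^ 3 / ((q : ℂ) ^ 2 + 1) ^ 2 := by
    rw [kap, div_pow, div_mul_eq_mul_div, ← pow_succ]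
  rw [← hk]
  linear_combination kap q ^ 2 * q * basisNorm_mul_self_mul hq hn

end HRM

theorem mainTheorem6 (q w : ℕ) (hq : 2 ≤ q) (hw : 1 ≤ w) (z₂ : ℝ)
    (hz₂ : z₂ = (q : ℝ) ^ 2 / ((q : ℝ) ^ 2 + 1)) :
    -- `z₂` is the subleading eigenvalue: `1` is a simple eigenvalue and all others are smaller
    ((HRM.T q w).charpoly.rootMultiplicity 1 = 1 ∧
      ∀ z : ℂ, Module.End.HasEigenvalue (HRM.T q w) z → z = 1 ∨ z = (z₂ : ℂ) ∨ ‖z‖ < z₂) ∧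
    -- algebraic multiplicity `w`, geometric multiplicity one
    (HRM.T q w).charpoly.rootMultiplicity (z₂ : ℂ) = w ∧
    Module.finrank ℂ (Module.End.eigenspace (HRM.T q w) (z₂ : ℂ)) = 1 ∧
    -- on the generalized eigenspace, `T_w` is a single Jordan block
    (∃ b : Module.Basis (Fin w) ℂ (Module.End.maxGenEigenspace (HRM.T q w) (z₂ : ℂ)),
      ∀ j, HRM.T q w (b j) =
        ∑ i, HRM.jordanBlock w (z₂ : ℂ) i j • (b i : HRM.Space q w)) ∧
    -- `V_w` is invariant under `T_w` and its adjoint, and contains the generalized eigenspace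
    (∀ x ∈ HRM.V q w, HRM.T q w x ∈ HRM.V q w ∧
      LinearMap.adjoint (HRM.T q w) x ∈ HRM.V q w) ∧
    Module.End.maxGenEigenspace (HRM.T q w) (z₂ : ℂ) ≤ HRM.V q w ∧
    -- in the orthonormal basis `e_0, …, e_w` of `V_w`, `T_w` is lower-triangular
    Orthonormal ℂ (HRM.e q w) ∧
    Submodule.span ℂ (Set.range (HRM.e q w)) = HRM.V q w ∧
    (∀ m n : Fin (w + 1), m < n → inner ℂ (HRM.e q w m) (HRM.T q w (HRM.e q w n)) = 0) ∧
    (∀ m : Fin (w + 1), inner ℂ (HRM.e q w m) (HRM.T q w (HRM.e q w m)) =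
      if m.val = w then (1 : ℂ) else (z₂ : ℂ)) ∧
    (∀ m n : Fin (w + 1), n.val = m.val + 1 → n.val < w →
      inner ℂ (HRM.e q w n) (HRM.T q w (HRM.e q w m)) =
        (q : ℂ) ^ 3 / ((q : ℂ) ^ 2 + 1) ^ 2) := by
  have hk : (z₂ : ℂ) = HRM.kap q * q := by
    rw [hz₂, HRM.kap]
    push_cast
    ring
  have hz1 : z₂ < 1 := by
    rw [hz₂, div_lt_one (by positivity)]
    linarith
  have hz1' : (z₂ : ℂ) ≠ 1 := by exact_mod_cast hz1.ne
  have hz0 : 0 ≤ z₂ := by rw [hz₂]; positivity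
  -- off `V_w` all eigenvalues are at most `q³/(q²+1)²`, and `q < q² + 1`
  have hsmall : ‖HRM.kap q‖ ^ 2 * q < z₂ := by
    have hq0 : (0 : ℝ) < q := by exact_mod_cast (by omega : 0 < q)
    rw [HRM.norm_kap, hz₂, div_pow, div_mul_eq_mul_div, div_lt_div_iff₀ (by positivity)
      (by positivity)]
    have : (q : ℝ) < (q : ℝ) ^ 2 + 1 := by nlinarith [sq_nonneg ((q : ℝ) - 1)]
    have h2 := mul_lt_mul_of_pos_left this
      (by positivity : 0 < (q : ℝ) ^ 2 * ((q : ℝ) ^ 2 + 1))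
    linarith
  have hinv : ∀ x ∈ HRM.V q w, HRM.T q w x ∈ HRM.V q w ∧
      LinearMap.adjoint (HRM.T q w) x ∈ HRM.V q w :=
    fun x hx => ⟨HRM.T_mem_V hq hx, HRM.adjoint_T_mem_V hq hx⟩
  have hgen : ∀ z : ℂ, z₂ ≤ ‖z‖ →
      Module.End.maxGenEigenspace (HRM.T q w) z ≤ HRM.V q w := by
    intro z hz
    refine HRM.maxGenEigenspace_le_of_orthogonal _ _ hinv z fun x hx hTx => ?_
    by_contra hx0
    exact absurd (HRM.norm_le_of_mem_orthogonal_V hq hx hx0 hTx) (not_le.2 (hsmall.trans_le hz))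
  have hspan := HRM.span_e hq w
  have horth := HRM.orthonormal_e hq w
  have htri : ∀ m n : Fin (w + 1), m < n →
      inner ℂ (HRM.e q w m) (HRM.T q w (HRM.e q w n)) = (0 : ℂ) :=
    fun m n h => HRM.inner_e_T_e_of_lt hq h
  have hdiag : ∀ m : Fin (w + 1), inner ℂ (HRM.e q w m) (HRM.T q w (HRM.e q w m)) =
      if m.val = w then (1 : ℂ) else (z₂ : ℂ) := fun m => by
    rw [HRM.inner_e_T_e_self hq, hk]
  have hsub : ∀ m n : Fin (w + 1), n.val = m.val + 1 → n.val < w →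
      inner ℂ (HRM.e q w n) (HRM.T q w (HRM.e q w m)) =
        (q : ℂ) ^ 3 / ((q : ℂ) ^ 2 + 1) ^ 2 := fun m n h hn => HRM.inner_e_T_e_succ hq h hn
  have hU : ∀ x ∈ Submodule.span ℂ (Set.range (HRM.e q w)),
      HRM.T q w x ∈ Submodule.span ℂ (Set.range (HRM.e q w)) := by
    rw [hspan]
    exact fun x hx => (hinv x hx).1
  have hroot : ∀ z : ℂ, z₂ ≤ ‖z‖ → (HRM.T q w).charpoly.rootMultiplicity z =
      (if z = z₂ then w else 0) + (if z = 1 then 1 else 0) := by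
    intro z hz
    rw [HRM.rootMultiplicity_charpoly_restrict _ _ hU z (hspan ▸ hgen z hz),
      HRM.charpoly_restrict_of_triangular horth hU htri hdiag, Polynomial.rootMultiplicity_mul
        (mul_ne_zero (pow_ne_zero _ (Polynomial.X_sub_C_ne_zero _))
          (Polynomial.X_sub_C_ne_zero _)), Polynomial.rootMultiplicity_X_sub_C]
    congr 1
    split_ifs with h
    · rw [h, Polynomial.rootMultiplicity_X_sub_C_pow]
    · refine Polynomial.rootMultiplicity_eq_zero ?_
      simpa [Polynomial.IsRoot, sub_eq_zero] using fun h' => absurd h' h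
  have hn2 : z₂ ≤ ‖(z₂ : ℂ)‖ := by rw [Complex.norm_real]; exact le_abs_self _
  have hn1 : z₂ ≤ ‖(1 : ℂ)‖ := by rw [norm_one]; exact hz1.le
  have hmult : (HRM.T q w).charpoly.rootMultiplicity (z₂ : ℂ) = w := by
    rw [hroot _ hn2, if_pos rfl, if_neg hz1', add_zero]
  have hne : (HRM.T q w).charpoly ≠ 0 := (LinearMap.charpoly_monic _).ne_zero
  have hq0 : (q : ℂ) ≠ 0 := by exact_mod_cast (by omega : q ≠ 0)
  have hle1 : Module.finrank ℂ (Module.End.eigenspace (HRM.T q w) (z₂ : ℂ)) ≤ 1 :=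
    HRM.finrank_eigenspace_le_one_of_triangular hw hz1' horth
      (hspan ▸ (Module.End.genEigenspace_le_maximal _ _ _).trans (hgen _ hn2)) htri hdiag
      fun m n h hn => by
        rw [hsub m n h hn]
        exact div_ne_zero (pow_ne_zero _ hq0) (pow_ne_zero _ (HRM.sq_add_one_ne_zero q))
  have heig : Module.End.HasEigenvalue (HRM.T q w) (z₂ : ℂ) := by
    rw [Module.End.hasEigenvalue_iff_isRoot_charpoly, ← Polynomial.rootMultiplicity_pos hne, hmult]
    exact hw
  refine ⟨⟨?_, ?_⟩, hmult, ?_, ?_, hinv, hgen _ hn2, horth, hspan, htri, hdiag, hsub⟩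
  · rw [hroot _ hn1, if_neg hz1'.symm, if_pos rfl]
  · intro z hz
    by_contra! h
    rw [Module.End.hasEigenvalue_iff_isRoot_charpoly, ← Polynomial.rootMultiplicity_pos hne,
      hroot z h.2.2, if_neg h.2.1, if_neg h.1] at hz
    exact lt_irrefl _ hz
  · exact le_antisymm hle1 (Submodule.one_le_finrank_iff.2 heig)
  · exact HRM.exists_jordan_basis _ _ hw
      ((LinearMap.finrank_maxGenEigenspace_eq _ _).trans hmult) hle1
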